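/- An $O(N)^3$-invariant (tetrahedral) graph is a finite graph $G$ with edges colored by $\{0,1,2,3\}$ (parallel edges allowed, no loops), in which every vertex is incident to exactly one edge of each color, and in which every connected component of the subgraph of colors $1,2,3$ is a tetrahedral bubble, i.e. a complete graph on four vertices in which opposite edges have the same color. A face of color $i\in\{1,2,3\}$ is a cycle of colors $\{0,i\}$, and its length is the number of its edges of color $0$. The jacket $J_i$ is $G$ with the edges of color $i$ deleted; its faces are all its bicolored cycles, and its genus $g_i\in\frac12\mathbb Z$ is defined for connected $G$ by $2-2g_i=V(J_i)-E(J_i)+F(J_i)$. The degree of $G$ is $\omega(G)=g_1+g_2+g_3$. The graph $G$ is 2PI (2-particle-irreducible) if there are no two distinct edges of color $0$ whose removal disconnects $G$, and dipole-free if no face of length two passes through two distinct bubbles. Let $G_{\mathrm{oct}}$ be the following graph with six bubbles. Its vertices are the $24$ ordered pairs $(p,q)$ of adjacent vertices of the octahedron with vertices $\pm e_1,\pm e_2,\pm e_3$. The edges of color $0$ join $(p,q)$ to $(q,p)$; those of color $3$ join $(p,q)$ to $(p,-q)$; those of color $1$ (respectively $2$) join $(p,q)$ to $(p,r)$, where $p,q,r$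 are the corners of a face of the octahedron and the product of their three signs is $+1$ (respectively $-1$). Theorem. The graph $G_{\mathrm{oct}}$ is connected, 2PI, dipole-free and of degree $1$. Conversely, every connected, 2PI, dipole-free $O(N)^3$-invariant graph of degree $1$ is isomorphic to $G_{\mathrm{oct}}$, up to a permutation of the colors $1,2,3$. -/

import Mathlib

universe u v

/-- A finite `O(N)³`-invariant Feynman graph with tetrahedral interactions, on the vertex set `V`.
Every vertex has exactly one half-edge of each color `0, 1, 2, 3`, so a color `c` is a
fixed-point-free involution `nbr c` that sends a vertex to the other end of its edge of color `c`
(edges of different colors may be parallel). Color `0` is the propagator. The condition `tetra`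
says that the four vertices `v`, `nbr 1 v`, `nbr 2 v`, `nbr 3 v` carry the tetrahedral bubble:
the complete graph on four vertices, opposite edges having the same color. -/
structure TetraGraph (V : Type u) where
  nbr : Fin 4 → V → V
  nbr_nbr : ∀ c x, nbr c (nbr c x) = x
  nbr_ne : ∀ c x, nbr c x ≠ x
  tetra : ∀ x, nbr 1 (nbr 2 x) = nbr 3 x

namespace TetraGraph

variable {V : Type u} {W : Type v}

/-- The adjacency relation of the graph that keeps only the edges with colors in `S`. -/
def keep (G : TetraGraph V) (S : Finset (Fin 4)) : SimpleGraph V where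
  Adj x y := ∃ c ∈ S, G.nbr c x = y
  symm := ⟨by
    rintro x y ⟨c, hc, rfl⟩
    exact ⟨c, hc, G.nbr_nbr c x⟩⟩
  loopless := ⟨by
    rintro x ⟨c, -, h⟩
    exact G.nbr_ne c x h⟩

/-- The graph is connected (in particular it has a vertex). -/
def IsConnected (G : TetraGraph V) : Prop := (G.keep Finset.univ).Connected

/-- The edges of color `c`, as unordered pairs of vertices. -/
def edges (G : TetraGraph V) (c : Fin 4) : Set (Sym2 V) :=
  Set.range fun x => s(x, G.nbr c x)

/-- The bubbles: connected components of the graph without the edges of color `0`. -/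
abbrev Bubble (G : TetraGraph V) : Type u := (G.keep {1, 2, 3}).ConnectedComponent

/-- The bubble that contains a vertex. -/
def bubble (G : TetraGraph V) (x : V) : G.Bubble := (G.keep {1, 2, 3}).connectedComponentMk x

/-- The faces of color `i` (for `i ≠ 0`): bicolored cycles with colors `0` and `i`. -/
abbrev Face (G : TetraGraph V) (i : Fin 4) : Type u := (G.keep {0, i}).ConnectedComponent

/-- The length of a face: the number of its edges of color `0`. -/
noncomputable def faceLength (G : TetraGraph V) {i : Fin 4} (f : G.Face i) : ℕ :=
  {e ∈ G.edges 0 | ∀ x ∈ e, x ∈ f.supp}.ncard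

/-- The number of edges of the jacket `J i`, in which the edges of color `i` are deleted. -/
noncomputable def jacketEdges (G : TetraGraph V) (i : Fin 4) : ℕ :=
  ∑ c ∈ Finset.univ.erase i, (G.edges c).ncard

/-- The number of faces of the jacket `J i`: the bicolored cycles for the three pairs of colors
other than `i`. -/
noncomputable def jacketFaces (G : TetraGraph V) (i : Fin 4) : ℕ :=
  ∑ S ∈ (Finset.univ.erase i).powersetCard 2, Nat.card (G.keep S).ConnectedComponent

/-- The (possibly half-integral) genus `g` of the jacket `J i`, given by Euler's formula
`2 - 2 g = V - E + F`. -/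
noncomputable def jacketGenus (G : TetraGraph V) (i : Fin 4) : ℚ :=
  (2 - ((Nat.card V : ℚ) - G.jacketEdges i + G.jacketFaces i)) / 2

/-- The degree: the sum of the genera of the three jackets. -/
noncomputable def degree (G : TetraGraph V) : ℚ :=
  G.jacketGenus 1 + G.jacketGenus 2 + G.jacketGenus 3

/-- The graph that is left when the edges of color `0` in `T` are removed. -/
def cut (G : TetraGraph V) (T : Set (Sym2 V)) : SimpleGraph V where
  Adj x y := ∃ c, G.nbr c x = y ∧ ¬ (c = 0 ∧ s(x, y) ∈ T)
  symm := ⟨by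
    rintro x y ⟨c, rfl, h⟩
    exact ⟨c, G.nbr_nbr c x, by rwa [Sym2.eq_swap]⟩⟩
  loopless := ⟨by
    rintro x ⟨c, h, -⟩
    exact G.nbr_ne c x h⟩

/-- 2-particle-irreducible: there is no pair of edges of color `0` whose removal disconnects the
graph. -/
def Is2PI (G : TetraGraph V) : Prop :=
  ∀ e ∈ G.edges 0, ∀ e' ∈ G.edges 0, e ≠ e' → (G.cut {e, e'}).Connected

/-- A dipole of color `i`: two distinct bubbles with a common face of color `i` and length two. -/
def HasDipole (G : TetraGraph V) (i : Fin 4) : Prop :=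
  ∃ f : G.Face i, G.faceLength f = 2 ∧ ∃ x ∈ f.supp, ∃ y ∈ f.supp,
    G.bubble x ≠ G.bubble y

/-- The graph has no dipole of any of the colors `1, 2, 3`. -/
def DipoleFree (G : TetraGraph V) : Prop := ∀ i, i ≠ 0 → ¬ G.HasDipole i

/-- The two graphs are the same up to the names of the vertices and a permutation of the colors
`1, 2, 3`. -/
def SameUpToColors (G : TetraGraph V) (H : TetraGraph W) : Prop :=
  ∃ (φ : V ≃ W) (π : Equiv.Perm (Fin 4)), π 0 = 0 ∧
    ∀ c x, φ (G.nbr c x) = H.nbr (π c) (φ x)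

end TetraGraph

/-- A vertex of the octahedron: the unit vector `(-1) ^ s • e a` is the pair `(a, s)`. -/
abbrev OctVertex : Type := ZMod 3 × ZMod 2

/-- The pairs of adjacent vertices of the octahedron: `(p, q)` is the half-edge at `p` that points
to `q`. -/
abbrev OctHalfEdge : Type := {h : OctVertex × OctVertex // h.1.1 ≠ h.2.1}

/-- The third corner `r` of the face of the octahedron that contains `p` and `q` and whose three
signs have the product `(-1) ^ t`; the axes of `p`, `q`, `r` are the three elements of `ZMod 3`,
whose sum is `0`. -/
def octThird (t : ZMod 2) (p q : OctVertex) : OctVertex :=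
  (-p.1 - q.1, t - p.2 - q.2)

/-- The graph with six bubbles, one at each vertex `p` of the octahedron, with the four half-edges
`(p, q)` as its vertices. An edge of color `0` joins `(p, q)` to `(q, p)`. At the bubble `p`, color
`1` joins two half-edges that span a positive face of the octahedron, color `2` joins two that span
a negative face, and color `3` joins two opposite ones. The jacket `J 3` is thus drawn on the
sphere as the octahedron whose vertices are blown up to squares, and its faces of colors `1` and
`2` are the eight triangles, in checkerboard coloring. -/
def octahedralGraph : TetraGraph OctHalfEdge where
  nbr := ![
    fun h => ⟨(h.1.2, h.1.1), h.2.symm⟩,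
    fun h => ⟨(h.1.1, octThird 0 h.1.1 h.1.2), by revert h; decide +kernel⟩,
    fun h => ⟨(h.1.1, octThird 1 h.1.1 h.1.2), by revert h; decide +kernel⟩,
    fun h => ⟨(h.1.1, (h.1.2.1, h.1.2.2 + 1)), h.2⟩]
  nbr_nbr := by decide +kernel
  nbr_ne := by decide +kernel
  tetra := by decide +kernel

/-! Let `n` be the number of bubbles and `F i` the number of faces of color `i`. Counting gives `2 *
g_k = n + 2 - F i - F j`, so the degree is `3 + 3 * n / 2 - (F 1 + F 2 + F 3)`. The genera are
nonnegative half-integers; if their sum is `1`, one of them is zero. For that planar jacket `J k`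
one has `F i + F j = n + 2` and `2 * F k = n`.

View `J k` as a four-valent map on the sphere, with the bubbles as crossings and the faces of color
`k` as the closed curves that go straight ahead. The lengths of the faces of each color sum to `2 *
n`. 2PI forbids faces of length one, and then dipole-freeness forbids length two, so all lengths are
at least three. Closed curves on a sphere cross evenly, so each loop of color `k` has even length,
hence at least four; the average is four, so each length is four. Parity applied to a petal of a
loop then excludes self-crossings. Some face of color `i` or `j` is a triangle, since otherwise `4 *
(n + 2) ≤ 4 * n`. The three loops through its sides are distinct and cross pairwise, hence at least
twice each; this uses up their length, and by connectedness there is no other loop. So `n = 6`, and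
counting makes every face of color `i` or `j` a triangle.

Now `nbr i`, `nbr 0`, `nbr j` satisfy the Coxeter relations of type `A₃`. The group of order 24 acts
transitively on 24 vertices, which determines the graph.

The topology of the sphere enters through linear algebra over `ZMod 2`: `card_face_add_card_face_le`
bounds the span of the face boundaries by the cycle space, with equality in the planar case, and
`four_dvd_ncard_crossing` deduces the crossing parity. -/

namespace TetraGraph

variable {V : Type u}

/-! ### Closed sets, and the bubble colors as a Klein four-group -/

theorem mem_of_reachable_of_closed {H : SimpleGraph V} {T : Set V}
    (hT : ∀ x ∈ T, ∀ y, H.Adj x y → y ∈ T) {x y : V} (hx : x ∈ T) (h : H.Reachable x y) :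
    y ∈ T := by
  obtain ⟨p⟩ := h
  induction p with
  | nil => exact hx
  | cons hadj _ ih => exact ih (hT _ hx _ hadj)

theorem nbr_injective (G : TetraGraph V) (c : Fin 4) : Function.Injective (G.nbr c) :=
  Function.LeftInverse.injective (G.nbr_nbr c)

theorem nbr_eq_iff (G : TetraGraph V) {c : Fin 4} {x y : V} : G.nbr c x = y ↔ x = G.nbr c y :=
  ⟨fun h => by rw [← h, G.nbr_nbr], fun h => by rw [h, G.nbr_nbr]⟩

theorem mk_nbr (G : TetraGraph V) {S : Finset (Fin 4)} {c : Fin 4} (hc : c ∈ S) (x : V) :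
    (G.keep S).connectedComponentMk (G.nbr c x) = (G.keep S).connectedComponentMk x :=
  SimpleGraph.ConnectedComponent.connectedComponentMk_eq_of_adj ⟨c, hc, G.nbr_nbr c x⟩

theorem mem_of_mk_eq_mk (G : TetraGraph V) {S : Finset (Fin 4)} {T : Set V}
    (hT : ∀ c ∈ S, ∀ x ∈ T, G.nbr c x ∈ T) {x y : V} (hx : x ∈ T)
    (h : (G.keep S).connectedComponentMk y = (G.keep S).connectedComponentMk x) : y ∈ T := by
  refine mem_of_reachable_of_closed (H := G.keep S) ?_ hx
    (SimpleGraph.ConnectedComponent.exact h.symm)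
  rintro x hx y ⟨c, hc, rfl⟩
  exact hT c hc x hx

/-- `i`, `j`, `k` are the colors `1`, `2`, `3` in some order. -/
def IsTriple (i j k : Fin 4) : Prop := i ≠ 0 ∧ j ≠ 0 ∧ k ≠ 0 ∧ i ≠ j ∧ i ≠ k ∧ j ≠ k

theorem IsTriple.rotate {i j k : Fin 4} (h : IsTriple i j k) : IsTriple j k i := by
  unfold IsTriple at *; tauto

theorem IsTriple.swap {i j k : Fin 4} (h : IsTriple i j k) : IsTriple j i k := by
  unfold IsTriple at *; tauto

theorem exists_isTriple {i : Fin 4} (hi : i ≠ 0) : ∃ j k, IsTriple i j k := by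
  unfold IsTriple; revert i; decide

theorem IsTriple.eq_or {i j k : Fin 4} (h : IsTriple i j k) (c : Fin 4) :
    c = 0 ∨ c = i ∨ c = j ∨ c = k := by
  unfold IsTriple at h; revert i j k c; decide

theorem IsTriple.cases {i j k : Fin 4} (h : IsTriple i j k) :
    (i = 1 ∧ j = 2 ∧ k = 3) ∨ (i = 2 ∧ j = 1 ∧ k = 3) ∨ (i = 1 ∧ j = 3 ∧ k = 2) ∨
    (i = 2 ∧ j = 3 ∧ k = 1) ∨ (i = 3 ∧ j = 1 ∧ k = 2) ∨ (i = 3 ∧ j = 2 ∧ k = 1) := by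
  unfold IsTriple at h; revert i j k; decide

/-- The product of two of the colors `1`, `2`, `3` is the third one. -/
theorem nbr_mul (G : TetraGraph V) {i j k : Fin 4} (h : IsTriple i j k) (x : V) :
    G.nbr i (G.nbr j x) = G.nbr k x := by
  have h12 := G.tetra
  -- The product of the involutions `nbr 1` and `nbr 2` is again an involution, so they commute.
  have h21 : ∀ x, G.nbr 2 (G.nbr 1 x) = G.nbr 3 x := fun x => by
    have := G.nbr_nbr 3 x
    rw [← h12, ← h12 x, G.nbr_eq_iff, G.nbr_eq_iff, G.nbr_eq_iff] at this
    rw [← h12 x, this, G.nbr_nbr]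
  have h13 : ∀ x, G.nbr 1 (G.nbr 3 x) = G.nbr 2 x := fun x => by rw [← h12, G.nbr_nbr]
  have h23 : ∀ x, G.nbr 2 (G.nbr 3 x) = G.nbr 1 x := fun x => by rw [← h21, G.nbr_nbr]
  have h31 : ∀ x, G.nbr 3 (G.nbr 1 x) = G.nbr 2 x := fun x => by rw [← h21, G.nbr_nbr]
  have h32 : ∀ x, G.nbr 3 (G.nbr 2 x) = G.nbr 1 x := fun x => by rw [← h12, G.nbr_nbr]
  rcases h.cases with ⟨rfl, rfl, rfl⟩ | ⟨rfl, rfl, rfl⟩ | ⟨rfl, rfl, rfl⟩ |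
    ⟨rfl, rfl, rfl⟩ | ⟨rfl, rfl, rfl⟩ | ⟨rfl, rfl, rfl⟩
  exacts [h12 x, h21 x, h13 x, h23 x, h31 x, h32 x]

/-! ### Counting components, edges and faces -/

theorem card_eq_sum_ncard_supp [Finite V] (H : SimpleGraph V) [Fintype H.ConnectedComponent] :
    Nat.card V = ∑ C : H.ConnectedComponent, C.supp.ncard := by
  rw [← Nat.card_congr (Equiv.sigmaFiberEquiv H.connectedComponentMk), Nat.card_sigma]
  rfl

theorem card_eq_mul_card_component [Finite V] (H : SimpleGraph V) (m : ℕ)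
    (h : ∀ x, (H.connectedComponentMk x).supp.ncard = m) :
    Nat.card V = m * Nat.card H.ConnectedComponent := by
  classical
  have := Fintype.ofFinite H.ConnectedComponent
  rw [card_eq_sum_ncard_supp H, Finset.sum_congr rfl (g := fun _ => m)]
  · simp [mul_comm]
  · intro C _
    induction C using SimpleGraph.ConnectedComponent.ind with
    | h x => exact h x

theorem two_mul_ncard_edges_of_closed [Finite V] (G : TetraGraph V) (c : Fin 4) {S : Set V}
    (hS : ∀ x ∈ S, G.nbr c x ∈ S) : 2 * {e ∈ G.edges c | ∀ x ∈ e, x ∈ S}.ncard = S.ncard := by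
  classical
  have := Fintype.ofFinite V
  rw [Set.ncard_eq_toFinset_card', Set.ncard_eq_toFinset_card',
    Finset.card_eq_sum_card_fiberwise (f := fun x => s(x, G.nbr c x))
      (t := {e ∈ G.edges c | ∀ x ∈ e, x ∈ S}.toFinset)]
  · rw [Finset.sum_congr rfl (g := fun _ => 2)]
    · simp [mul_comm]
    · intro e he
      obtain ⟨⟨x, rfl⟩, hx⟩ : e ∈ G.edges c ∧ ∀ x ∈ e, x ∈ S := by simpa using he
      have hxS : x ∈ S := hx x (by simp)
      rw [Finset.card_eq_two]
      refine ⟨x, G.nbr c x, (G.nbr_ne c x).symm, ?_⟩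
      ext y
      simp only [Finset.mem_filter, Set.mem_toFinset, Sym2.eq_iff, Finset.mem_insert,
        Finset.mem_singleton]
      constructor
      · rintro ⟨-, h | h⟩
        · exact Or.inl h.1
        · exact Or.inr h.1
      · rintro (rfl | rfl)
        · exact ⟨hxS, Or.inl ⟨rfl, rfl⟩⟩
        · exact ⟨hS _ hxS, Or.inr ⟨rfl, G.nbr_nbr c x⟩⟩
  · intro x hx
    have hx : x ∈ S := by simpa using hx
    simp only [Set.coe_toFinset, Set.mem_ofPred_eq, Sym2.mem_iff]
    refine ⟨⟨x, rfl⟩, ?_⟩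
    rintro y (rfl | rfl)
    exacts [hx, hS _ hx]

theorem two_mul_ncard_edges [Finite V] (G : TetraGraph V) (c : Fin 4) :
    2 * (G.edges c).ncard = Nat.card V := by
  simpa using G.two_mul_ncard_edges_of_closed c (S := Set.univ) (by simp)

theorem two_mul_faceLength [Finite V] (G : TetraGraph V) {i : Fin 4} (f : G.Face i) :
    2 * G.faceLength f = f.supp.ncard := by
  refine G.two_mul_ncard_edges_of_closed 0 fun x hx => ?_
  rw [SimpleGraph.ConnectedComponent.mem_supp_iff] at *
  rw [G.mk_nbr (by simp), hx]

theorem sum_faceLength [Finite V] (G : TetraGraph V) (i : Fin 4) [Fintype (G.Face i)] :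
    2 * ∑ f : G.Face i, G.faceLength f = Nat.card V := by
  rw [card_eq_sum_ncard_supp (G.keep {0, i}), Finset.mul_sum]
  exact Finset.sum_congr rfl fun f _ => G.two_mul_faceLength f

/-- Turning around a face of color `c`: the edge of color `0`, then the edge of color `c`. -/
def turn (G : TetraGraph V) (c : Fin 4) (x : V) : V := G.nbr c (G.nbr 0 x)

theorem turn_injective (G : TetraGraph V) (c : Fin 4) : Function.Injective (G.turn c) :=
  (G.nbr_injective c).comp (G.nbr_injective 0)

theorem turn_nbr_turn (G : TetraGraph V) (c : Fin 4) (x : V) :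
    G.turn c (G.nbr 0 (G.turn c x)) = G.nbr 0 x := by
  simp [turn, G.nbr_nbr]

/-- The two directions around a face never merge: cancelling one turn at each end by `turn_nbr_turn`
lowers the exponent by two, until `nbr 0` or `nbr c` would have a fixed point. -/
theorem iterate_turn_ne (G : TetraGraph V) (c : Fin 4) (n : ℕ) (x : V) :
    (G.turn c)^[n] x ≠ G.nbr 0 x := by
  induction n using Nat.strong_induction_on generalizing x with
  | _ n ih =>
    match n with
    | 0 => exact (G.nbr_ne 0 x).symm
    | 1 => exact G.nbr_ne c _
    | n + 2 =>
      intro h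
      rw [← G.turn_nbr_turn c x, Function.iterate_succ_apply', Function.iterate_succ_apply] at h
      exact ih n (by omega) _ (G.turn_injective c h)

theorem mk_iterate_turn (G : TetraGraph V) (c : Fin 4) (n : ℕ) (x : V) :
    (G.keep {0, c}).connectedComponentMk ((G.turn c)^[n] x) =
      (G.keep {0, c}).connectedComponentMk x := by
  induction n with
  | zero => rfl
  | succ n ih =>
    rw [Function.iterate_succ_apply', turn, G.mk_nbr (by simp), G.mk_nbr (by simp), ih]

theorem isPeriodicPt_turn [Finite V] (G : TetraGraph V) (c : Fin 4) (x : V) :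
    x ∈ Function.periodicPts (G.turn c) :=
  (G.turn_injective c).mem_periodicPts x

/-- A face consists of two orbits of `turn`, one for each direction, exchanged by `nbr 0`. -/
theorem mem_face_iff [Finite V] (G : TetraGraph V) (c : Fin 4) {x y : V} :
    (G.keep {0, c}).connectedComponentMk y = (G.keep {0, c}).connectedComponentMk x ↔
      ∃ n < Function.minimalPeriod (G.turn c) x,
        y = (G.turn c)^[n] x ∨ y = G.nbr 0 ((G.turn c)^[n] x) := by
  set l := Function.minimalPeriod (G.turn c) x with hl
  have hpos : 0 < l := Function.minimalPeriod_pos_of_mem_periodicPts (G.isPeriodicPt_turn c x)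
  constructor
  · intro h
    have hy : y ∈ {y | ∃ n, y = (G.turn c)^[n] x ∨ y = G.nbr 0 ((G.turn c)^[n] x)} := by
      refine G.mem_of_mk_eq_mk ?_ ⟨0, Or.inl rfl⟩ h
      intro d hd z hz
      obtain ⟨n, hn⟩ := hz
      rw [Finset.mem_insert, Finset.mem_singleton] at hd
      rcases hd with rfl | rfl
      · rcases hn with rfl | rfl
        · exact ⟨n, Or.inr rfl⟩
        · exact ⟨n, Or.inl (G.nbr_nbr _ _)⟩
      · rcases hn with rfl | rfl
        -- One step back along the orbit is taken as `l - 1` steps forward, which also covers `n =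
        -- 0`.
        · refine ⟨n + (l - 1), Or.inr ?_⟩
          have h1 : (G.turn d)^[n] x = (G.turn d)^[n + (l - 1) + 1] x := by
            rw [show n + (l - 1) + 1 = n + l by omega, Function.iterate_add_apply]
            rw [hl, Function.iterate_minimalPeriod]
          rw [h1, Function.iterate_succ_apply', turn, G.nbr_nbr]
        · exact ⟨n + 1, Or.inl (by rw [Function.iterate_succ_apply', turn])⟩
    obtain ⟨n, hn⟩ := hy
    exact ⟨n % l, Nat.mod_lt _ hpos, by rwa [hl, Function.iterate_mod_minimalPeriod_eq]⟩
  · rintro ⟨n, -, rfl | rfl⟩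
    · exact G.mk_iterate_turn c n x
    · rw [G.mk_nbr (by simp)]; exact G.mk_iterate_turn c n x

/-- One period of `turn` lists each edge of color `0` of the face exactly once, because by
`iterate_turn_ne` no edge is met again in the opposite direction. -/
theorem faceLength_mk [Finite V] (G : TetraGraph V) (c : Fin 4) (x : V) :
    G.faceLength ((G.keep {0, c}).connectedComponentMk x : G.Face c) =
      Function.minimalPeriod (G.turn c) x := by
  set l := Function.minimalPeriod (G.turn c) x with hl
  have himg : {e ∈ G.edges 0 | ∀ y ∈ e, y ∈ ((G.keep {0, c}).connectedComponentMk x).supp} =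
      (fun n => s((G.turn c)^[n] x, G.nbr 0 ((G.turn c)^[n] x))) '' Set.Iio l := by
    ext e
    constructor
    · rintro ⟨⟨y, rfl⟩, hy⟩
      have := hy y (by simp)
      rw [SimpleGraph.ConnectedComponent.mem_supp_iff, G.mem_face_iff] at this
      obtain ⟨n, hn, rfl | rfl⟩ := this
      · exact ⟨n, hn, rfl⟩
      · exact ⟨n, hn, by simp [G.nbr_nbr, Sym2.eq_swap]⟩
    · rintro ⟨n, hn, rfl⟩
      refine ⟨⟨_, rfl⟩, ?_⟩
      intro y hy
      rw [SimpleGraph.ConnectedComponent.mem_supp_iff, G.mem_face_iff]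
      exact ⟨n, hn, by simpa using hy⟩
  have hne : ∀ a b, b ≤ a → (G.turn c)^[a] x ≠ G.nbr 0 ((G.turn c)^[b] x) := by
    intro a b hab
    obtain ⟨d, rfl⟩ := Nat.exists_eq_add_of_le' hab
    rw [Function.iterate_add_apply]
    exact G.iterate_turn_ne c d _
  rw [faceLength, himg, Set.InjOn.ncard_image]
  · rw [← Finset.coe_range, Set.ncard_coe_finset, Finset.card_range]
  · intro a ha b hb h
    simp only [Sym2.eq_iff] at h
    rcases h with h | h
    · exact Function.iterate_injOn_Iio_minimalPeriod ha hb h.1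
    · rcases le_total b a with hab | hab
      · exact (hne a b hab h.1).elim
      · exact (hne b a hab h.2.symm).elim

/-! ### Bubbles -/

theorem nbr_ne_nbr (G : TetraGraph V) {i j : Fin 4} (hi : i ≠ 0) (hj : j ≠ 0) (hij : i ≠ j)
    (x : V) : G.nbr i x ≠ G.nbr j x := by
  obtain ⟨k, hk⟩ : ∃ k, IsTriple j i k := by
    unfold IsTriple; revert i j; decide
  rw [Ne, eq_comm, G.nbr_eq_iff, G.nbr_mul hk]
  exact (G.nbr_ne k x).symm

theorem mk_eq_mk_iff_of_subset (G : TetraGraph V) {i j k : Fin 4} (h : IsTriple i j k)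
    {S : Finset (Fin 4)} (h0 : 0 ∉ S) (hi : i ∈ S) (hj : j ∈ S) {x y : V} :
    (G.keep S).connectedComponentMk y = (G.keep S).connectedComponentMk x ↔
      y ∈ ({x, G.nbr i x, G.nbr j x, G.nbr k x} : Set V) := by
  constructor
  · refine G.mem_of_mk_eq_mk ?_ (by simp)
    rintro c hc y (rfl | rfl | rfl | rfl) <;> rcases h.eq_or c with rfl | rfl | rfl | rfl <;>
      first
      | exact absurd hc h0
      | simp [G.nbr_nbr, G.nbr_mul h, G.nbr_mul h.rotate, G.nbr_mul h.rotate.rotate,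
          G.nbr_mul h.swap, G.nbr_mul h.swap.rotate, G.nbr_mul h.swap.rotate.rotate]
  · rintro (rfl | rfl | rfl | rfl)
    · rfl
    · exact G.mk_nbr hi x
    · exact G.mk_nbr hj x
    · rw [← G.nbr_mul h, G.mk_nbr hi, G.mk_nbr hj]

theorem ncard_supp_eq_four (G : TetraGraph V) {i j k : Fin 4} (h : IsTriple i j k)
    {S : Finset (Fin 4)} (h0 : 0 ∉ S) (hi : i ∈ S) (hj : j ∈ S) (x : V) :
    ((G.keep S).connectedComponentMk x).supp.ncard = 4 := by
  have hsupp : ((G.keep S).connectedComponentMk x).supp =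
      {x, G.nbr i x, G.nbr j x, G.nbr k x} := by
    ext y
    rw [SimpleGraph.ConnectedComponent.mem_supp_iff, G.mk_eq_mk_iff_of_subset h h0 hi hj]
  have h1 := G.nbr_ne_nbr h.1 h.2.1 h.2.2.2.1 x
  have h2 := G.nbr_ne_nbr h.1 h.2.2.1 h.2.2.2.2.1 x
  have h3 := G.nbr_ne_nbr h.2.1 h.2.2.1 h.2.2.2.2.2 x
  rw [hsupp, Set.ncard_insert_of_notMem, Set.ncard_insert_of_notMem, Set.ncard_pair h3]
  · simp [h1, h2]
  · simp [(G.nbr_ne _ x).symm]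

theorem four_mul_card_component (G : TetraGraph V) [Finite V] {i j k : Fin 4}
    (h : IsTriple i j k) {S : Finset (Fin 4)} (h0 : 0 ∉ S) (hi : i ∈ S) (hj : j ∈ S) :
    Nat.card V = 4 * Nat.card (G.keep S).ConnectedComponent :=
  card_eq_mul_card_component _ 4 (G.ncard_supp_eq_four h h0 hi hj)

theorem isTriple_one_two_three : IsTriple 1 2 3 := by unfold IsTriple; decide

theorem four_mul_card_bubble (G : TetraGraph V) [Finite V] :
    Nat.card V = 4 * Nat.card G.Bubble :=
  G.four_mul_card_component isTriple_one_two_three (by decide) (by decide) (by decide)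

theorem ncard_supp_bubble (G : TetraGraph V) (x : V) : (G.bubble x).supp.ncard = 4 :=
  G.ncard_supp_eq_four isTriple_one_two_three (by decide) (by decide) (by decide) x

theorem bubble_nbr (G : TetraGraph V) {c : Fin 4} (hc : c ≠ 0) (x : V) :
    G.bubble (G.nbr c x) = G.bubble x :=
  G.mk_nbr (by revert c; decide) x

theorem bubble_eq_iff (G : TetraGraph V) {i j k : Fin 4} (h : IsTriple i j k) {x y : V} :
    G.bubble y = G.bubble x ↔ y ∈ ({x, G.nbr i x, G.nbr j x, G.nbr k x} : Set V) := by
  have key : ∀ i : Fin 4, i ≠ 0 → i ∈ ({1, 2, 3} : Finset (Fin 4)) := by decide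
  exact G.mk_eq_mk_iff_of_subset h (by decide) (key i h.1) (key j h.2.1)

/-! ### The degree -/

/-- Here `V = 4 * n` and `E = 6 * n` for `n` bubbles, and the bicolored cycles of colors `j`, `k`
correspond to the bubbles. -/
theorem jacketGenus_eq [Finite V] (G : TetraGraph V) {i j k : Fin 4} (h : IsTriple i j k) :
    G.jacketGenus i = (2 + (Nat.card G.Bubble : ℚ) -
      Nat.card (G.Face j) - Nat.card (G.Face k)) / 2 := by
  have hedges : G.jacketEdges i = 6 * Nat.card G.Bubble := by
    have : ∀ c, (G.edges c).ncard = 2 * Nat.card G.Bubble := fun c => by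
      have := G.two_mul_ncard_edges c
      have := G.four_mul_card_bubble
      omega
    simp [jacketEdges, this]
    ring
  have hfaces : G.jacketFaces i =
      Nat.card (G.Face j) + Nat.card (G.Face k) + Nat.card G.Bubble := by
    have hS : (Finset.univ.erase i).powersetCard 2 = {{0, j}, {0, k}, {j, k}} := by
      clear hedges; unfold IsTriple at h; revert i j k; decide
    have h1 : ({0, j} : Finset (Fin 4)) ∉ ({{0, k}, {j, k}} : Finset (Finset (Fin 4))) := by
      clear hedges hS; unfold IsTriple at h; revert i j k; decide
    have h2 : ({0, k} : Finset (Fin 4)) ∉ ({{j, k}} : Finset (Finset (Fin 4))) := by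
      clear hedges hS h1; unfold IsTriple at h; revert i j k; decide
    have h3 : Nat.card (G.keep {j, k}).ConnectedComponent = Nat.card G.Bubble := by
      have h4 := G.four_mul_card_component h.rotate (S := {j, k})
        (by simp [h.2.1.symm, h.2.2.1.symm]) (by simp) (by simp)
      have := G.four_mul_card_bubble
      omega
    rw [jacketFaces, hS, Finset.sum_insert h1, Finset.sum_insert h2, Finset.sum_singleton, h3]
    ring
  rw [jacketGenus, hedges, hfaces, G.four_mul_card_bubble]
  push_cast
  ring

theorem degree_eq [Finite V] (G : TetraGraph V) :
    G.degree = (6 + 3 * (Nat.card G.Bubble : ℚ) -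
      2 * (Nat.card (G.Face 1) + Nat.card (G.Face 2) + Nat.card (G.Face 3))) / 2 := by
  have h := isTriple_one_two_three
  rw [degree, G.jacketGenus_eq h, G.jacketGenus_eq h.rotate, G.jacketGenus_eq h.rotate.rotate]
  ring

/-! ### The cycle space over the field with two elements -/

/-- The functions that are constant on the components of the graph with colors in `S`. -/
def constOn (G : TetraGraph V) (S : Finset (Fin 4)) : Submodule (ZMod 2) (V → ZMod 2) where
  carrier := {x | ∀ c ∈ S, ∀ v, x (G.nbr c v) = x v}
  add_mem' hx hy c hc v := by simp [hx c hc v, hy c hc v]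
  zero_mem' _ _ _ := rfl
  smul_mem' a x hx c hc v := by simp [hx c hc v]

theorem constOn_inf (G : TetraGraph V) (S T : Finset (Fin 4)) :
    G.constOn S ⊓ G.constOn T = G.constOn (S ∪ T) := by
  ext x
  constructor
  · rintro ⟨h1, h2⟩ c hc
    rcases Finset.mem_union.1 hc with hc | hc
    exacts [h1 c hc, h2 c hc]
  · exact fun h => ⟨fun c hc => h c (Finset.mem_union_left _ hc),
      fun c hc => h c (Finset.mem_union_right _ hc)⟩

theorem apply_eq_of_mem_constOn (G : TetraGraph V) {S : Finset (Fin 4)} {x : V → ZMod 2}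
    (hx : x ∈ G.constOn S) {v w : V}
    (h : (G.keep S).connectedComponentMk w = (G.keep S).connectedComponentMk v) : x w = x v :=
  G.mem_of_mk_eq_mk (T := {w | x w = x v}) (fun c hc w hw => (hx c hc w).trans hw) rfl h

/-- A function that is constant on components is a function of the component. -/
def constOnEquiv (G : TetraGraph V) (S : Finset (Fin 4)) :
    ((G.keep S).ConnectedComponent → ZMod 2) ≃ₗ[ZMod 2] G.constOn S where
  toFun y := ⟨fun v => y ((G.keep S).connectedComponentMk v),
    fun c hc v => congrArg y (G.mk_nbr hc v)⟩
  map_add' _ _ := rfl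
  map_smul' _ _ := rfl
  invFun x C := C.lift x.1 fun _ _ p _ => G.apply_eq_of_mem_constOn x.2
    (SimpleGraph.ConnectedComponent.sound ⟨p⟩)
  left_inv y := by
    funext C
    induction C using SimpleGraph.ConnectedComponent.ind with
    | h v => rfl
  right_inv x := rfl

theorem finrank_constOn [Finite V] (G : TetraGraph V) (S : Finset (Fin 4)) :
    Module.finrank (ZMod 2) (G.constOn S) = Nat.card (G.keep S).ConnectedComponent := by
  have := Fintype.ofFinite (G.keep S).ConnectedComponent
  rw [← (G.constOnEquiv S).finrank_eq, Module.finrank_fintype_fun_eq_card,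
    Nat.card_eq_fintype_card]

theorem finrank_constOn_of_isConnected [Finite V] (G : TetraGraph V) (hG : G.IsConnected)
    {i j k : Fin 4} (h : IsTriple i j k) {S : Finset (Fin 4)} (h0 : 0 ∈ S) (hi : i ∈ S)
    (hj : j ∈ S) : Module.finrank (ZMod 2) (G.constOn S) = 1 := by
  have hS : G.constOn S = G.constOn Finset.univ := by
    refine le_antisymm (fun x hx c _ v => ?_) fun x hx c _ => hx c (Finset.mem_univ c)
    rcases h.eq_or c with rfl | rfl | rfl | rfl
    · exact hx _ h0 v
    · exact hx _ hi v
    · exact hx _ hj v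
    · rw [← G.nbr_mul h, hx _ hi, hx _ hj]
  rw [hS, finrank_constOn, Nat.card_eq_one_iff_unique]
  obtain ⟨v⟩ := hG.nonempty
  exact ⟨hG.preconnected.subsingleton_connectedComponent, ⟨SimpleGraph.connectedComponentMk _ v⟩⟩

theorem card_component_singleton [Finite V] (G : TetraGraph V) (c : Fin 4) :
    Nat.card V = 2 * Nat.card (G.keep {c}).ConnectedComponent := by
  refine card_eq_mul_card_component _ 2 fun x => ?_
  rw [← Set.ncard_pair (G.nbr_ne c x).symm]
  congr 1
  ext y
  rw [SimpleGraph.ConnectedComponent.mem_supp_iff]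
  constructor
  · refine G.mem_of_mk_eq_mk ?_ (by simp)
    rintro d hd y (rfl | rfl) <;> obtain rfl := Finset.mem_singleton.1 hd <;> simp [G.nbr_nbr]
  · rintro (rfl | rfl)
    exacts [rfl, G.mk_nbr (by simp) x]

/-- The indicator functions (modulo two) of sets of edges of color `0` that meet every bubble an
even number of times. -/
def IsCycle (G : TetraGraph V) (z : V → ZMod 2) : Prop :=
  (∀ v, z (G.nbr 0 v) = z v) ∧ ∀ v, z v + z (G.nbr 1 v) + z (G.nbr 2 v) + z (G.nbr 3 v) = 0

theorem isCycle_of_mem_constOn (G : TetraGraph V) {i : Fin 4} (hi : i ≠ 0) {x : V → ZMod 2}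
    (hx : x ∈ G.constOn {0, i}) : G.IsCycle x := by
  refine ⟨hx 0 (by simp), fun v => ?_⟩
  have hi' := hx i (by simp)
  have h := isTriple_one_two_three
  have key : i = 1 ∨ i = 2 ∨ i = 3 := by clear hi' hx; revert i; decide
  rcases key with rfl | rfl | rfl
  · rw [← G.nbr_mul h v, hi', hi']
    linear_combination CharTwo.add_self_eq_zero (x v) +
      CharTwo.add_self_eq_zero (x (G.nbr 2 v))
  · rw [← G.nbr_mul h.swap v, hi', hi']
    linear_combination CharTwo.add_self_eq_zero (x v) +
      CharTwo.add_self_eq_zero (x (G.nbr 1 v))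
  · rw [← G.nbr_mul h.swap.rotate.rotate v, hi', hi']
    linear_combination CharTwo.add_self_eq_zero (x v) +
      CharTwo.add_self_eq_zero (x (G.nbr 2 v))

theorem IsCycle.dotProduct_eq_zero_of_mem_constOn_zero [Fintype V] {G : TetraGraph V}
    {z y : V → ZMod 2} (hz : G.IsCycle z) (hy : y ∈ G.constOn {0}) : ∑ v, y v * z v = 0 := by
  refine Finset.sum_involution (fun v _ => G.nbr 0 v) (fun v _ => ?_) (fun v _ _ => G.nbr_ne 0 v)
    (fun _ _ => Finset.mem_univ _) (fun v _ => G.nbr_nbr 0 v)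
  rw [hz.1, hy 0 (by simp), CharTwo.add_self_eq_zero]

theorem IsCycle.dotProduct_eq_zero_of_mem_constOn_bubble [Fintype V] {G : TetraGraph V}
    {z y : V → ZMod 2} (hz : G.IsCycle z) (hy : y ∈ G.constOn {1, 2, 3}) :
    ∑ v, y v * z v = 0 := by
  classical
  have := Fintype.ofFinite G.Bubble
  rw [← Finset.sum_fiberwise (g := G.bubble)]
  refine Finset.sum_eq_zero fun b _ => ?_
  induction b using SimpleGraph.ConnectedComponent.ind with
  | h x =>
    have h := isTriple_one_two_three
    have hfib : Finset.univ.filter (fun v => G.bubble v = (G.keep {1, 2, 3}).connectedComponentMk x)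
        = {x, G.nbr 1 x, G.nbr 2 x, G.nbr 3 x} := by
      ext y
      have := G.bubble_eq_iff h (x := x) (y := y)
      simpa [bubble] using this
    rw [hfib, Finset.sum_insert, Finset.sum_insert, Finset.sum_insert, Finset.sum_singleton,
      hy 1 (by simp), hy 2 (by simp), hy 3 (by simp)]
    · linear_combination y x * hz.2 x
    · simpa using G.nbr_ne_nbr h.2.1 h.2.2.1 h.2.2.2.2.2 x
    · simpa using ⟨G.nbr_ne_nbr h.1 h.2.1 h.2.2.2.1 x, G.nbr_ne_nbr h.1 h.2.2.1 h.2.2.2.2.1 x⟩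
    · simp [(G.nbr_ne _ x).symm]

/-- The number of faces of the jacket `J k` obeys `F i + F j ≤ n + 2`. In the planar case, in which
equality holds, the boundaries of the faces span the cycle space. -/
theorem card_face_add_card_face_le [Finite V] (G : TetraGraph V) (hG : G.IsConnected)
    {i j k : Fin 4} (h : IsTriple i j k) :
    Nat.card (G.Face i) + Nat.card (G.Face j) ≤ Nat.card G.Bubble + 2 ∧
    (Nat.card (G.Face i) + Nat.card (G.Face j) = Nat.card G.Bubble + 2 →
      ∀ z, G.IsCycle z → ∃ x ∈ G.constOn {0, i}, ∃ y ∈ G.constOn {0, j}, x + y = z) := by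
  have := Fintype.ofFinite V
  let B : LinearMap.BilinForm (ZMod 2) (V → ZMod 2) := dotProductBilin (ZMod 2) (ZMod 2)
  have hB : B.Nondegenerate := by
    refine ⟨fun x hx => dotProduct_eq_zero_iff.1 hx, fun x hx => dotProduct_eq_zero_iff.1 ?_⟩
    intro y
    rw [dotProduct_comm]
    exact hx y
  -- Orthogonality to the two summands expresses the two conditions of `IsCycle`; only the inclusion
  -- of the cycles in `Z` is needed.
  set Z := B.orthogonal (G.constOn {0} ⊔ G.constOn {1, 2, 3}) with hZ
  have hcyc : ∀ z, G.IsCycle z → z ∈ Z := by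
    intro z hz
    rw [hZ, LinearMap.BilinForm.mem_orthogonal_iff]
    intro y hy
    obtain ⟨y1, hy1, y2, hy2, rfl⟩ := Submodule.mem_sup.1 hy
    change B (y1 + y2) z = 0
    rw [map_add, LinearMap.add_apply]
    have e1 : B y1 z = 0 := hz.dotProduct_eq_zero_of_mem_constOn_zero hy1
    have e2 : B y2 z = 0 := hz.dotProduct_eq_zero_of_mem_constOn_bubble hy2
    rw [e1, e2, add_zero]
  have hV := G.four_mul_card_bubble
  -- With `n` bubbles, the dimension is `4 * n - (2 * n + n - 1)`; the two summands meet in the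
  -- constants, as the graph is connected.
  have hdimZ : Module.finrank (ZMod 2) Z = Nat.card G.Bubble + 1 := by
    have h1 := Submodule.finrank_sup_add_finrank_inf_eq (G.constOn {0}) (G.constOn {1, 2, 3})
    rw [constOn_inf, G.finrank_constOn_of_isConnected hG isTriple_one_two_three (by decide)
      (by decide) (by decide), finrank_constOn, finrank_constOn] at h1
    have h2 := G.card_component_singleton 0
    have h3 : Nat.card (G.keep {1, 2, 3}).ConnectedComponent = Nat.card G.Bubble := rfl
    have h4 : 0 < Nat.card G.Bubble := by
      obtain ⟨v⟩ := hG.nonempty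
      have : Nonempty G.Bubble := ⟨G.bubble v⟩
      exact Nat.card_pos
    rw [hZ, LinearMap.BilinForm.finrank_orthogonal hB, Module.finrank_fintype_fun_eq_card,
      ← Nat.card_eq_fintype_card]
    omega
  have hle : G.constOn {0, i} ⊔ G.constOn {0, j} ≤ Z :=
    sup_le (fun x hx => hcyc x (G.isCycle_of_mem_constOn h.1 hx))
      fun x hx => hcyc x (G.isCycle_of_mem_constOn h.2.1 hx)
  have hdim := Submodule.finrank_sup_add_finrank_inf_eq (G.constOn {0, i}) (G.constOn {0, j})
  rw [constOn_inf, G.finrank_constOn_of_isConnected hG h (by simp) (by simp) (by simp),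
    finrank_constOn, finrank_constOn] at hdim
  have hle' := Submodule.finrank_mono hle
  change _ + 1 = Nat.card (G.Face i) + Nat.card (G.Face j) at hdim
  refine ⟨by omega, fun heq z hz => ?_⟩
  have hsup := Submodule.eq_of_le_of_finrank_eq hle (by omega)
  have hz' := hcyc z hz
  rw [← hsup] at hz'
  exact Submodule.mem_sup.1 hz'

/-! ### Intersection parity in a planar jacket -/

theorem even_card_of_involution [Finite V] (S : Set V) (f : V → V) (hf : ∀ x, f (f x) = x)
    (hne : ∀ x, f x ≠ x) (hS : ∀ x ∈ S, f x ∈ S) : Even S.ncard := by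
  classical
  have := Fintype.ofFinite V
  rw [Set.ncard_eq_toFinset_card', ← ZMod.natCast_eq_zero_iff_even, Finset.card_eq_sum_ones,
    Nat.cast_sum]
  exact Finset.sum_involution (fun x _ => f x) (fun _ _ => by decide) (fun x _ _ => hne x)
    (fun x hx => by simpa using hS x (by simpa using hx)) (fun x _ => hf x)

/-- Let `J k` be planar, and let `D` be a union of faces of color `k` that has no edge in common
with the cycle `z`. Then `z` and `D` have an even number of crossings; each of them is counted
twice here. -/
theorem four_dvd_ncard_crossing [Finite V] (G : TetraGraph V) (hG : G.IsConnected)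
    {i j k : Fin 4} (h : IsTriple i j k)
    (hp : Nat.card (G.Face i) + Nat.card (G.Face j) = Nat.card G.Bubble + 2)
    {z : V → ZMod 2} (hz : G.IsCycle z) {D : Set V} (hD0 : ∀ v ∈ D, G.nbr 0 v ∈ D)
    (hDk : ∀ v ∈ D, G.nbr k v ∈ D) (hzD : ∀ v ∈ D, z v = 0) :
    4 ∣ {v ∈ D | z (G.nbr j v) = 1}.ncard := by
  obtain ⟨x, hx, y, hy, rfl⟩ := (G.card_face_add_card_face_le hG h).2 hp z hz
  have hxy : ∀ v ∈ D, x v = y v := fun v hv => CharTwo.add_eq_zero.1 (hzD v hv)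
  -- On `D` the face functions `x` and `y` agree, so `x` changes along an edge of color `k` exactly
  -- where `z` crosses; along edges of color `0` it does not change.
  have hs : ∀ v ∈ D, x (G.nbr k v) = x v + (x + y) (G.nbr j v) := by
    intro v hv
    rw [← G.nbr_mul h, hx i (by simp), Pi.add_apply, hy j (by simp), hxy v hv]
    linear_combination - CharTwo.add_self_eq_zero (y v)
  have h01 : ∀ a : ZMod 2, a = 0 ∨ a = 1 := by decide
  set X1 := {v ∈ D | x v = 1 ∧ x (G.nbr k v) = 0} with hX1
  have hXimg : {v ∈ D | (x + y) (G.nbr j v) = 1} = X1 ∪ G.nbr k '' X1 := by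
    ext v
    constructor
    · rintro ⟨hv, hv1⟩
      have h1 := hs v hv
      rw [hv1] at h1
      rcases h01 (x v) with h0 | h0
      · refine Or.inr ⟨G.nbr k v, ⟨hDk v hv, by rw [h1, h0]; rfl, ?_⟩, G.nbr_nbr k v⟩
        rw [G.nbr_nbr, h0]
      · exact Or.inl ⟨hv, h0, by rw [h1, h0]; rfl⟩
    · rintro (⟨hv, h1, h2⟩ | ⟨w, ⟨hv, h1, h2⟩, rfl⟩)
      · have := hs v hv
        rw [h1, h2] at this
        exact ⟨hv, by linear_combination -this - CharTwo.add_self_eq_zero (1 : ZMod 2)⟩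
      · have := hs _ (hDk w hv)
        rw [G.nbr_nbr, h1, h2] at this
        exact ⟨hDk w hv, by linear_combination -this⟩
  have hdisj : Disjoint X1 (G.nbr k '' X1) := by
    rw [Set.disjoint_left]
    rintro v ⟨-, -, h2⟩ ⟨w, ⟨-, h1, h3⟩, rfl⟩
    rw [G.nbr_nbr, h1] at h2
    exact one_ne_zero h2
  -- Where `x = 1` on `D`, the edges of color `0` pair all vertices, and those of color `k` pair the
  -- vertices outside `X1`.
  have heven : Even X1.ncard := by
    have e1 := even_card_of_involution {v ∈ D | x v = 1} (G.nbr 0) (G.nbr_nbr 0) (G.nbr_ne 0)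
      fun v hv => ⟨hD0 v hv.1, (hx 0 (by simp) v).trans hv.2⟩
    have e2 := even_card_of_involution {v ∈ D | x v = 1 ∧ x (G.nbr k v) = 1} (G.nbr k)
      (G.nbr_nbr k) (G.nbr_ne k)
      fun v hv => ⟨hDk v hv.1, hv.2.2, by rw [G.nbr_nbr]; exact hv.2.1⟩
    have hun : {v ∈ D | x v = 1} = X1 ∪ {v ∈ D | x v = 1 ∧ x (G.nbr k v) = 1} := by
      ext v
      constructor
      · rintro ⟨hv, h1⟩
        rcases h01 (x (G.nbr k v)) with h0 | h0
        exacts [Or.inl ⟨hv, h1, h0⟩, Or.inr ⟨hv, h1, h0⟩]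
      · rintro (⟨hv, h1, -⟩ | ⟨hv, h1, -⟩) <;> exact ⟨hv, h1⟩
    rw [hun, Set.ncard_union_eq, Nat.even_add] at e1
    · exact e1.2 e2
    · rw [Set.disjoint_left]
      rintro v ⟨-, -, h2⟩ ⟨-, -, h3⟩
      rw [h2] at h3
      exact zero_ne_one h3
  rw [hXimg, Set.ncard_union_eq hdisj, Set.ncard_image_of_injective _ (G.nbr_injective k)]
  obtain ⟨m, hm⟩ := heven
  exact ⟨m, by omega⟩

/-! ### Short faces -/

theorem ncard_pair_le (a b : V) : ({a, b} : Set V).ncard ≤ 2 :=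
  (Set.ncard_insert_le _ _).trans (by simp)

theorem eq_univ_of_closed (G : TetraGraph V) (hG : G.IsConnected) {T : Set V} {x : V} (hx : x ∈ T)
    (hT : ∀ c, ∀ y ∈ T, G.nbr c y ∈ T) (y : V) : y ∈ T := by
  refine mem_of_reachable_of_closed ?_ hx (hG.preconnected x y)
  rintro y hy z ⟨c, -, rfl⟩
  exact hT c y hy

/-- If an edge of color `0` is parallel to one of color `c`, only two half-edges lead out of the
bubble, and cutting them separates it from all other bubbles. -/
theorem nbr_zero_ne [Finite V] (G : TetraGraph V) (hG : G.IsConnected) (h2 : G.Is2PI)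
    (hV : 1 < Nat.card G.Bubble) {c : Fin 4} (hc : c ≠ 0) (x : V) :
    G.nbr 0 x ≠ G.nbr c x := by
  intro hx
  obtain ⟨d, e, h⟩ := exists_isTriple hc
  have hx' : G.nbr 0 (G.nbr c x) = x := by rw [← hx, G.nbr_nbr]
  have hall : ∀ y, G.bubble y = G.bubble x := by
    -- `Is2PI` speaks of distinct edges; if the two remaining half-edges form one edge, the bubble
    -- is already closed off.
    by_cases hee : s(G.nbr d x, G.nbr 0 (G.nbr d x)) = s(G.nbr e x, G.nbr 0 (G.nbr e x))
    · have hde : G.nbr 0 (G.nbr d x) = G.nbr e x := by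
        rw [Sym2.eq_iff] at hee
        rcases hee with hee | hee
        · exact (G.nbr_ne_nbr h.2.1 h.2.2.1 h.2.2.2.2.2 x hee.1).elim
        · exact hee.2
      refine G.eq_univ_of_closed hG (T := {y | G.bubble y = G.bubble x}) rfl fun b y hy => ?_
      by_cases hb : b = 0
      · subst hb
        rcases (G.bubble_eq_iff h).1 hy with rfl | rfl | rfl | rfl <;>
          refine (G.bubble_eq_iff h).2 ?_
        · simp [hx]
        · simp [hx']
        · simp [hde]
        · simp [← hde, G.nbr_nbr]
      · exact (G.bubble_nbr hb y).trans hy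
    · have hcut := h2 _ ⟨_, rfl⟩ _ ⟨_, rfl⟩ hee
      intro y
      refine mem_of_reachable_of_closed (T := {y | G.bubble y = G.bubble x}) ?_ rfl
        (hcut.preconnected x y)
      rintro y hy z ⟨b, rfl, hb'⟩
      by_cases hb : b = 0
      · subst hb
        rcases (G.bubble_eq_iff h).1 hy with rfl | rfl | rfl | rfl
        · exact (G.bubble_eq_iff h).2 (by simp [hx])
        · exact (G.bubble_eq_iff h).2 (by simp [hx'])
        · exact (hb' ⟨rfl, by simp⟩).elim
        · exact (hb' ⟨rfl, by simp⟩).elim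
      · exact (G.bubble_nbr hb y).trans hy
  have : Nat.card G.Bubble ≤ 1 := by
    rw [Finite.card_le_one_iff_subsingleton]
    refine ⟨fun a b => ?_⟩
    induction a, b using SimpleGraph.ConnectedComponent.ind₂ with
    | h a b => exact (hall a).trans (hall b).symm
  omega

theorem bubble_nbr_zero_ne [Finite V] (G : TetraGraph V) (hG : G.IsConnected) (h2 : G.Is2PI)
    (hV : 1 < Nat.card G.Bubble) (x : V) : G.bubble (G.nbr 0 x) ≠ G.bubble x := by
  intro hx
  have h := isTriple_one_two_three
  rcases (G.bubble_eq_iff h).1 hx with hx | hx | hx | hx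
  · exact G.nbr_ne 0 x hx
  · exact G.nbr_zero_ne hG h2 hV h.1 x hx
  · exact G.nbr_zero_ne hG h2 hV h.2.1 x hx
  · exact G.nbr_zero_ne hG h2 hV h.2.2.1 x hx

theorem three_le_faceLength [Finite V] (G : TetraGraph V) (hG : G.IsConnected) (h2 : G.Is2PI)
    (hd : G.DipoleFree) (hV : 1 < Nat.card G.Bubble) {c : Fin 4} (hc : c ≠ 0) (f : G.Face c) :
    3 ≤ G.faceLength f := by
  induction f using SimpleGraph.ConnectedComponent.ind with
  | h x =>
    have hpos := Function.minimalPeriod_pos_of_mem_periodicPts (G.isPeriodicPt_turn c x)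
    have h1 : Function.minimalPeriod (G.turn c) x ≠ 1 := by
      intro h1
      rw [Function.minimalPeriod_eq_one_iff_isFixedPt] at h1
      exact G.nbr_zero_ne hG h2 hV hc x (G.nbr_eq_iff.1 h1)
    have h2 : Function.minimalPeriod (G.turn c) x ≠ 2 := by
      intro h3
      refine hd c hc ⟨(G.keep {0, c}).connectedComponentMk x, ?_, G.nbr 0 x, ?_, x, rfl,
        G.bubble_nbr_zero_ne hG h2 hV x⟩
      · rw [G.faceLength_mk, h3]
      · exact G.mk_nbr (by simp) x
    rw [G.faceLength_mk]
    omega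

/-- The lengths of the faces of one color sum to half the number of vertices, that is, twice the
number of bubbles. -/
theorem mul_card_face_le [Finite V] (G : TetraGraph V) {c : Fin 4} {m : ℕ}
    (hm : ∀ f : G.Face c, m ≤ G.faceLength f) :
    m * Nat.card (G.Face c) ≤ 2 * Nat.card G.Bubble := by
  have := Fintype.ofFinite (G.Face c)
  have h1 := Finset.card_nsmul_le_sum Finset.univ G.faceLength m fun f _ => hm f
  have h2 : 2 * Finset.univ.sum G.faceLength = _ := G.sum_faceLength c
  have h3 := G.four_mul_card_bubble
  rw [smul_eq_mul, Finset.card_univ, ← Nat.card_eq_fintype_card, mul_comm] at h1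
  omega

theorem faceLength_eq_of_mul_card_face [Finite V] (G : TetraGraph V) {c : Fin 4} {m : ℕ}
    (hm : ∀ f : G.Face c, m ≤ G.faceLength f)
    (hc : m * Nat.card (G.Face c) = 2 * Nat.card G.Bubble) (f : G.Face c) :
    G.faceLength f = m := by
  have := Fintype.ofFinite (G.Face c)
  have h2 := G.sum_faceLength c
  have h3 := G.four_mul_card_bubble
  have h4 : ∑ f : G.Face c, m = ∑ f : G.Face c, G.faceLength f := by
    rw [Finset.sum_const, smul_eq_mul, Finset.card_univ, ← Nat.card_eq_fintype_card, mul_comm]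
    omega
  exact ((Finset.sum_eq_sum_iff_of_le fun f _ => hm f).1 h4 f (Finset.mem_univ f)).symm

theorem four_dvd_ncard_of_closed [Finite V] (G : TetraGraph V) {S : Set V}
    (hS : ∀ c, c ≠ 0 → ∀ x ∈ S, G.nbr c x ∈ S) : 4 ∣ S.ncard := by
  classical
  have := Fintype.ofFinite V
  have h := isTriple_one_two_three
  rw [Set.ncard_eq_toFinset_card',
    Finset.card_eq_sum_card_image G.bubble]
  refine Finset.dvd_sum fun b hb => ?_
  obtain ⟨x, hx, rfl⟩ := Finset.mem_image.1 hb
  rw [Set.mem_toFinset] at hx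
  rw [← G.ncard_supp_bubble x, ← Set.ncard_coe_finset]
  refine dvd_of_eq (congrArg Set.ncard ?_)
  ext y
  simp only [Finset.coe_filter, Set.mem_toFinset]
  constructor
  · intro hy
    refine ⟨?_, hy⟩
    rcases (G.bubble_eq_iff h).1 hy with rfl | rfl | rfl | rfl
    exacts [hx, hS _ h.1 _ hx, hS _ h.2.1 _ hx, hS _ h.2.2.1 _ hx]
  · exact fun hy => hy.2

/-! ### The planar case -/

theorem isCycle_of_isTriple (G : TetraGraph V) {i j k : Fin 4} (h : IsTriple i j k)
    {z : V → ZMod 2} (h0 : ∀ v, z (G.nbr 0 v) = z v)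
    (hz : ∀ v, z v + z (G.nbr i v) + z (G.nbr j v) + z (G.nbr k v) = 0) : G.IsCycle z := by
  refine ⟨h0, fun v => ?_⟩
  have := hz v
  rcases h.cases with ⟨rfl, rfl, rfl⟩ | ⟨rfl, rfl, rfl⟩ | ⟨rfl, rfl, rfl⟩ |
    ⟨rfl, rfl, rfl⟩ | ⟨rfl, rfl, rfl⟩ | ⟨rfl, rfl, rfl⟩ <;> linear_combination this

/-- A connected, 2PI, dipole-free graph whose jacket `J k` is planar and which has as many faces
of color `k` as a graph of degree one. -/
structure PlanarCase (G : TetraGraph V) (i j k : Fin 4) : Prop where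
  triple : IsTriple i j k
  connected : G.IsConnected
  twoPI : G.Is2PI
  dipoleFree : G.DipoleFree
  planar : Nat.card (G.Face i) + Nat.card (G.Face j) = Nat.card G.Bubble + 2
  loops : 2 * Nat.card (G.Face k) = Nat.card G.Bubble

namespace PlanarCase

variable {G : TetraGraph V} {i j k : Fin 4}

theorem swap (P : PlanarCase G i j k) : PlanarCase G j i k :=
  ⟨P.triple.swap, P.connected, P.twoPI, P.dipoleFree, by rw [add_comm, P.planar], P.loops⟩

theorem one_lt_card_bubble [Finite V] (P : PlanarCase G i j k) : 1 < Nat.card G.Bubble := by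
  obtain ⟨x⟩ := P.connected.nonempty
  have : Nonempty G.Bubble := ⟨G.bubble x⟩
  have h1 : 0 < Nat.card G.Bubble := Nat.card_pos
  have h2 := P.loops
  omega

theorem nbr_zero_ne [Finite V] (P : PlanarCase G i j k) {c : Fin 4} (hc : c ≠ 0) (x : V) :
    G.nbr 0 x ≠ G.nbr c x :=
  G.nbr_zero_ne P.connected P.twoPI P.one_lt_card_bubble hc x

theorem three_le_faceLength [Finite V] (P : PlanarCase G i j k) {c : Fin 4} (hc : c ≠ 0)
    (f : G.Face c) : 3 ≤ G.faceLength f :=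
  G.three_le_faceLength P.connected P.twoPI P.dipoleFree P.one_lt_card_bubble hc f

theorem six_le_card_bubble [Finite V] (P : PlanarCase G i j k) : 6 ≤ Nat.card G.Bubble := by
  have h1 := G.mul_card_face_le (P.three_le_faceLength P.triple.1)
  have h2 := G.mul_card_face_le (P.three_le_faceLength P.triple.2.1)
  have h3 := P.planar
  omega

/-- A loop of color `k` crosses a union `D` of other loops an even number of times. -/
theorem four_dvd_ncard_crossing_face [Finite V] (P : PlanarCase G i j k) (f : G.Face k)
    {D : Set V} (hD0 : ∀ v ∈ D, G.nbr 0 v ∈ D) (hDk : ∀ v ∈ D, G.nbr k v ∈ D)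
    (hf : ∀ v ∈ D, v ∉ f.supp) : 4 ∣ {v ∈ D | G.nbr j v ∈ f.supp}.ncard := by
  classical
  let z : V → ZMod 2 := fun v => if v ∈ f.supp then 1 else 0
  have hz : G.IsCycle z := by
    refine G.isCycle_of_mem_constOn P.triple.2.2.1 fun c hc v => ?_
    simp only [z, SimpleGraph.ConnectedComponent.mem_supp_iff, G.mk_nbr hc]
  have := G.four_dvd_ncard_crossing P.connected P.triple P.planar hz hD0 hDk
    (fun v hv => if_neg (hf v hv))
  simpa [z] using this

/-- The average length is four, so it suffices that every length is even: each self-crossing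
contributes two to it, and the crossings with all the other loops are even in number. -/
theorem faceLength_eq_four [Finite V] (P : PlanarCase G i j k) (f : G.Face k) :
    G.faceLength f = 4 := by
  have h := P.triple
  refine G.faceLength_eq_of_mul_card_face (fun f => ?_) (by have := P.loops; omega) f
  have hk : ∀ v ∈ f.supp, G.nbr k v ∈ f.supp := fun v hv => (G.mk_nbr (by simp) v).trans hv
  have h0 : ∀ v ∈ f.supp, G.nbr 0 v ∈ f.supp := fun v hv => (G.mk_nbr (by simp) v).trans hv
  have hc := P.four_dvd_ncard_crossing_face f (D := f.suppᶜ)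
    (fun v hv hv' => hv (by simpa only [G.nbr_nbr] using h0 _ hv'))
    (fun v hv hv' => hv (by simpa only [G.nbr_nbr] using hk _ hv')) (fun v hv => hv)
  -- The self-crossings fill whole bubbles.
  have hs : 4 ∣ {v ∈ f.supp | G.nbr j v ∈ f.supp}.ncard := by
    refine G.four_dvd_ncard_of_closed fun c hc x hx => ?_
    have hjk : G.nbr j (G.nbr k x) ∈ f.supp := by
      rw [G.nbr_mul h.rotate, ← G.nbr_mul h.rotate.swap]
      exact hk _ hx.2
    rcases h.eq_or c with rfl | rfl | rfl | rfl
    · exact (hc rfl).elim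
    · rw [← G.nbr_mul h.rotate]
      exact ⟨hjk, by rw [G.nbr_nbr]; exact hk _ hx.1⟩
    · exact ⟨hx.2, by rw [G.nbr_nbr]; exact hx.1⟩
    · exact ⟨hk _ hx.1, hjk⟩
  have hsupp : f.supp = {v ∈ f.supp | G.nbr j v ∈ f.supp} ∪
      G.nbr j '' {v ∈ f.suppᶜ | G.nbr j v ∈ f.supp} := by
    ext v
    constructor
    · intro hv
      by_cases hv' : G.nbr j v ∈ f.supp
      · exact Or.inl ⟨hv, hv'⟩
      · exact Or.inr ⟨G.nbr j v, ⟨hv', by rwa [G.nbr_nbr]⟩, G.nbr_nbr j v⟩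
    · rintro (hv | ⟨w, hw, rfl⟩)
      exacts [hv.1, hw.2]
  have hcard : f.supp.ncard = {v ∈ f.supp | G.nbr j v ∈ f.supp}.ncard +
      {v ∈ f.suppᶜ | G.nbr j v ∈ f.supp}.ncard := by
    conv_lhs => rw [hsupp]
    rw [Set.ncard_union_eq, Set.ncard_image_of_injective _ (G.nbr_injective j)]
    rw [Set.disjoint_left]
    rintro v hv ⟨w, hw, rfl⟩
    have := hv.2
    rw [G.nbr_nbr] at this
    exact hw.1 this
  have h3 := P.three_le_faceLength h.2.2.1 f
  have hl := G.two_mul_faceLength f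
  omega

theorem iterate_turn_four [Finite V] (P : PlanarCase G i j k) (x : V) :
    G.nbr k (G.nbr 0 (G.nbr k (G.nbr 0 (G.nbr k (G.nbr 0 (G.nbr k (G.nbr 0 x))))))) = x := by
  have h1 := P.faceLength_eq_four ((G.keep {0, k}).connectedComponentMk x)
  rw [G.faceLength_mk] at h1
  have h2 := Function.iterate_minimalPeriod (f := G.turn k) (x := x)
  rw [h1] at h2
  exact h2

/-- If a loop of color `k` returns to the bubble of `v` after one crossing, then it crosses itself
there too. -/
theorem petal_crossing_mem [Finite V] (P : PlanarCase G i j k) {c d : Fin 4} (h : IsTriple c d k)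
    (hj : j = c ∨ j = d) {v : V} (hv : G.nbr c v = G.nbr 0 (G.nbr k (G.nbr 0 v))) :
    G.nbr j (G.nbr 0 v) ∈ ((G.keep {0, k}).connectedComponentMk v).supp := by
  classical
  set L := ((G.keep {0, k}).connectedComponentMk v).supp with hL
  have hLk : ∀ {w}, w ∈ L → G.nbr k w ∈ L := fun {w} hw => (G.mk_nbr (by simp) w).trans hw
  have hL0 : ∀ {w}, w ∈ L → G.nbr 0 w ∈ L := fun {w} hw => (G.mk_nbr (by simp) w).trans hw
  have hvL : v ∈ L := rfl
  have hcL : G.nbr c v ∈ L := hv ▸ hL0 (hLk (hL0 hvL))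
  have hdL : G.nbr d v ∈ L := by rw [← G.nbr_mul h.rotate.rotate]; exact hLk hcL
  have hjL : G.nbr j v ∈ L := by rcases hj with rfl | rfl <;> assumption
  have hjcL : G.nbr j (G.nbr c v) ∈ L := by
    rcases hj with rfl | rfl
    · rwa [G.nbr_nbr]
    · rw [G.nbr_mul h.swap]; exact hLk hvL
  let δ : V → V → ZMod 2 := fun a w => if w = a then 1 else 0
  -- This is the petal: two edges of color `0` that turn at the bubble of `v` and go straight
  -- through the bubble of `nbr 0 v`.
  let z : V → ZMod 2 := fun w =>
    δ v w + δ (G.nbr c v) w + δ (G.nbr 0 v) w + δ (G.nbr k (G.nbr 0 v)) w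
  have hδ : ∀ b a w, δ a (G.nbr b w) = δ (G.nbr b a) w := fun b a w => by
    simp only [δ, G.nbr_eq_iff]
  have h2 : (2 : ZMod 2) = 0 := rfl
  have hz : G.IsCycle z := by
    refine G.isCycle_of_isTriple h (fun w => ?_) fun w => ?_
    · simp only [z, hδ, G.nbr_nbr]
      rw [← hv, show G.nbr 0 (G.nbr c v) = G.nbr k (G.nbr 0 v) by rw [hv, G.nbr_nbr]]
      ring
    · simp only [z, hδ, G.nbr_nbr, G.nbr_mul h.rotate, G.nbr_mul h.rotate.rotate,
        G.nbr_mul h.swap, G.nbr_mul h.swap.rotate]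
      linear_combination (δ v w + δ (G.nbr c v) w + δ (G.nbr d v) w + δ (G.nbr k v) w +
        δ (G.nbr 0 v) w + δ (G.nbr c (G.nbr 0 v)) w + δ (G.nbr d (G.nbr 0 v)) w +
        δ (G.nbr k (G.nbr 0 v)) w) * h2
  have hz0 : ∀ w, z w ≠ 0 → w = v ∨ w = G.nbr c v ∨ w = G.nbr 0 v ∨ w = G.nbr k (G.nbr 0 v) := by
    intro w
    contrapose!
    rintro ⟨h1, h2, h3, h4⟩
    simp [z, δ, h1, h2, h3, h4]
  have hzL : ∀ w ∈ Lᶜ, z w = 0 := by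
    intro w hw
    by_contra hne
    rcases hz0 w hne with rfl | rfl | rfl | rfl
    exacts [hw hvL, hw hcL, hw (hL0 hvL), hw (hLk (hL0 hvL))]
  have hdvd := G.four_dvd_ncard_crossing P.connected P.triple P.planar hz (D := Lᶜ)
    (fun w hw hw' => hw (by simpa only [G.nbr_nbr] using hL0 hw'))
    (fun w hw hw' => hw (by simpa only [G.nbr_nbr] using hLk hw')) hzL
  by_contra hjo
  -- The bubble of `v` lies in the loop, so the petal could meet other loops only in the bubble of
  -- `nbr 0 v`: a single crossing, against parity.
  have hsub : {w ∈ Lᶜ | z (G.nbr j w) = 1} ⊆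
      {G.nbr j (G.nbr 0 v), G.nbr j (G.nbr k (G.nbr 0 v))} := by
    rintro w ⟨hw, hw1⟩
    rcases hz0 _ (by rw [hw1]; exact one_ne_zero) with h1 | h1 | h1 | h1 <;>
      rw [G.nbr_eq_iff] at h1 <;> subst h1
    · exact (hw hjL).elim
    · exact (hw hjcL).elim
    · simp
    · simp
  have hle := (Set.ncard_le_ncard hsub).trans (ncard_pair_le _ _)
  have hmem : G.nbr j (G.nbr 0 v) ∈ {w ∈ Lᶜ | z (G.nbr j w) = 1} := by
    refine ⟨hjo, ?_⟩
    rw [G.nbr_nbr]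
    simp [z, δ, G.nbr_ne, P.nbr_zero_ne h.1, (G.nbr_ne _ _).symm]
  have hpos := (Set.ncard_pos (Set.toFinite _)).2 ⟨_, hmem⟩
  have := Nat.le_of_dvd hpos hdvd
  omega

/-- No loop of color `k` crosses itself. -/
theorem nbr_notMem_face [Finite V] (P : PlanarCase G i j k) (v : V) :
    G.nbr j v ∉ ((G.keep {0, k}).connectedComponentMk v).supp := by
  intro hv
  have h := P.triple
  set L := ((G.keep {0, k}).connectedComponentMk v).supp with hL
  have hLk : ∀ {w}, w ∈ L → G.nbr k w ∈ L := fun {w} hw => (G.mk_nbr (by simp) w).trans hw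
  have hL0 : ∀ {w}, w ∈ L → G.nbr 0 w ∈ L := fun {w} hw => (G.mk_nbr (by simp) w).trans hw
  have hvL : v ∈ L := rfl
  have hjo : G.nbr j (G.nbr 0 v) ∈ L := by
    have hlen := P.faceLength_eq_four ((G.keep {0, k}).connectedComponentMk v)
    have h4 := P.iterate_turn_four v
    rw [G.faceLength_mk] at hlen
    obtain ⟨n, hn, hjv⟩ := (G.mem_face_iff k).1 hv
    rw [hlen] at hn
    -- The self-crossing splits the loop of length four into two petals. A petal of length one gives
    -- an edge of color `0` inside a bubble; what remains is two petals of length two.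
    interval_cases n <;>
      simp only [Function.iterate_succ_apply, Function.iterate_zero_apply, turn] at hjv <;>
      rcases hjv with hjv | hjv
    · exact (G.nbr_ne j v hjv).elim
    · exact (P.nbr_zero_ne h.2.1 v hjv.symm).elim
    · rw [eq_comm, G.nbr_eq_iff, G.nbr_mul h.rotate.swap] at hjv
      exact (P.nbr_zero_ne h.1 v hjv).elim
    · exact P.petal_crossing_mem h.swap (Or.inl rfl) hjv
    · rw [eq_comm, G.nbr_eq_iff, G.nbr_mul h.rotate.swap] at hjv
      exact P.petal_crossing_mem h (Or.inr rfl) hjv.symm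
    · rw [G.nbr_eq_iff, G.nbr_eq_iff, G.nbr_eq_iff] at h4
      rw [h4, eq_comm, G.nbr_eq_iff, G.nbr_mul h.rotate.swap, G.nbr_eq_iff] at hjv
      refine (P.nbr_zero_ne h.2.1 (G.nbr i v) ?_).elim
      rw [G.nbr_mul h.swap, hjv]
    · rw [← hjv, G.nbr_eq_iff] at h4
      refine (P.nbr_zero_ne h.1 (G.nbr j v) ?_).elim
      rw [G.nbr_mul h, h4]
    · rw [← hjv, G.nbr_mul h.rotate.swap] at h4
      exact (G.nbr_ne i v h4).elim
  have hbub : ∀ w ∈ L, G.nbr j w ∈ L → (G.bubble w).supp ⊆ L := by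
    intro w hw hjw y hy
    rcases (G.bubble_eq_iff h).1 hy with rfl | rfl | rfl | rfl
    · exact hw
    · rw [← G.nbr_mul h.rotate.swap]; exact hLk hjw
    · exact hjw
    · exact hLk hw
  -- Both bubbles lie in the loop and exhaust its eight vertices, so the loop is the whole graph,
  -- against `2 * F k = n ≥ 6`.
  have hLeq : (G.bubble v).supp ∪ (G.bubble (G.nbr 0 v)).supp = L := by
    refine Set.eq_of_subset_of_ncard_le
      (Set.union_subset (hbub v hvL hv) (hbub _ (hL0 hvL) hjo)) ?_
    rw [Set.ncard_union_eq, G.ncard_supp_bubble, G.ncard_supp_bubble, hL, ← G.two_mul_faceLength,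
      P.faceLength_eq_four]
    rw [Set.disjoint_left]
    intro w hw hw'
    exact G.bubble_nbr_zero_ne P.connected P.twoPI P.one_lt_card_bubble v (hw'.symm.trans hw)
  have hall := G.eq_univ_of_closed P.connected hvL fun c w hw => by
    by_cases hc : c = 0
    · exact hc ▸ hL0 hw
    · rw [← hLeq] at hw ⊢
      rcases hw with hw | hw
      · exact Or.inl ((G.bubble_nbr hc w).trans hw)
      · exact Or.inr ((G.bubble_nbr hc w).trans hw)
  have hone : Nat.card (G.Face k) ≤ 1 := by
    rw [Finite.card_le_one_iff_subsingleton]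
    refine ⟨fun a b => ?_⟩
    induction a, b using SimpleGraph.ConnectedComponent.ind₂ with
    | h a b => exact (hall a).trans (hall b).symm
  have h6 := P.six_le_card_bubble
  have hl := P.loops
  omega

/-- By parity `A` crosses both `B` and `C` at least twice, which accounts for all four steps of `A`.
-/
theorem nbr_mem_of_crossing [Finite V] (P : PlanarCase G i j k) {A B C : G.Face k} (hAB : A ≠ B)
    (hAC : A ≠ C) (hBC : B ≠ C) {a b : V} (haA : a ∈ A.supp) (haB : G.nbr j a ∈ B.supp)
    (hbA : b ∈ A.supp) (hbC : G.nbr j b ∈ C.supp) {w : V} (hw : w ∈ A.supp) :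
    G.nbr j w ∈ B.supp ∨ G.nbr j w ∈ C.supp := by
  have hAk : ∀ v ∈ A.supp, G.nbr k v ∈ A.supp := fun v hv => (G.mk_nbr (by simp) v).trans hv
  have hA0 : ∀ v ∈ A.supp, G.nbr 0 v ∈ A.supp := fun v hv => (G.mk_nbr (by simp) v).trans hv
  have h1 := P.four_dvd_ncard_crossing_face B hA0 hAk
    fun v hv hv' => hAB (SimpleGraph.ConnectedComponent.eq_of_common_vertex hv hv')
  have h2 := P.four_dvd_ncard_crossing_face C hA0 hAk
    fun v hv hv' => hAC (SimpleGraph.ConnectedComponent.eq_of_common_vertex hv hv')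
  have ha : a ∈ {v ∈ A.supp | G.nbr j v ∈ B.supp} := ⟨haA, haB⟩
  have hb : b ∈ {v ∈ A.supp | G.nbr j v ∈ C.supp} := ⟨hbA, hbC⟩
  have h1' := Nat.le_of_dvd ((Set.ncard_pos (Set.toFinite _)).2 ⟨a, ha⟩) h1
  have h2' := Nat.le_of_dvd ((Set.ncard_pos (Set.toFinite _)).2 ⟨b, hb⟩) h2
  have hun : {v ∈ A.supp | G.nbr j v ∈ B.supp} ∪ {v ∈ A.supp | G.nbr j v ∈ C.supp} = A.supp := by
    refine Set.eq_of_subset_of_ncard_le (Set.union_subset (fun v hv => hv.1) fun v hv => hv.1) ?_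
    rw [Set.ncard_union_eq, ← G.two_mul_faceLength, P.faceLength_eq_four]
    · omega
    · rw [Set.disjoint_left]
      exact fun v hv hv' =>
        hBC (SimpleGraph.ConnectedComponent.eq_of_common_vertex hv.2 hv'.2)
  rw [← hun] at hw
  rcases hw with hw | hw
  exacts [Or.inl hw.2, Or.inr hw.2]

/-- The three loops of color `k` through the edges of a triangle of color `i` are all the loops. -/
theorem card_face_le_three [Finite V] (P : PlanarCase G i j k) {x : V}
    (hx : (G.turn i)^[3] x = x) : Nat.card (G.Face k) ≤ 3 := by
  have h := P.triple
  let F : V → G.Face k := (G.keep {0, k}).connectedComponentMk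
  have hF0 : ∀ v, F (G.nbr 0 v) = F v := G.mk_nbr (by simp)
  have hFk : ∀ v, F (G.nbr k v) = F v := G.mk_nbr (by simp)
  have hFij : ∀ v, F (G.nbr j v) = F (G.nbr i v) := fun v => by
    rw [← G.nbr_mul h.rotate.rotate, hFk]
  have hne : ∀ v, F v ≠ F (G.nbr i v) := fun v hv =>
    P.nbr_notMem_face v ((hFij v).trans hv.symm)
  obtain ⟨y, hy⟩ : ∃ y, y = G.turn i x := ⟨_, rfl⟩
  obtain ⟨w, hw⟩ : ∃ w, w = G.turn i y := ⟨_, rfl⟩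
  have hxw : G.turn i w = x := by rw [hw, hy]; exact hx
  -- At the corner of the triangle between `a` and `turn i a`, the loops through these two vertices
  -- cross.
  have step : ∀ a, F (G.nbr i (G.turn i a)) = F a := fun a => by
    rw [turn, G.nbr_nbr, hF0]
  have cross : ∀ a, F (G.nbr j (G.nbr 0 a)) = F (G.turn i a) := fun a => hFij _
  have cross' : ∀ a, F (G.nbr j (G.turn i a)) = F a := fun a => by rw [hFij, step]
  have hxy : F x ≠ F y := fun e => hne y (by rw [← e, hy, step])
  have hyw : F y ≠ F w := fun e => hne w (by rw [← e, hw, step])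
  have hwx : F w ≠ F x := fun e => hne x (by rw [← e, ← step w, hxw])
  have closed : ∀ v, F v = F x ∨ F v = F y ∨ F v = F w := by
    intro v
    refine G.eq_univ_of_closed P.connected (T := {v | F v = F x ∨ F v = F y ∨ F v = F w})
      (Or.inl rfl) ?_ v
    have hj : ∀ v, (F v = F x ∨ F v = F y ∨ F v = F w) →
        (F (G.nbr j v) = F x ∨ F (G.nbr j v) = F y ∨ F (G.nbr j v) = F w) := by
      rintro v (hv | hv | hv)
      · exact Or.inr (P.nbr_mem_of_crossing hxy hwx.symm hyw (hF0 x)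
          ((cross x).trans (by rw [hy])) rfl (hxw ▸ cross' w : F (G.nbr j x) = F w) hv)
      · have := P.nbr_mem_of_crossing hyw hxy.symm hwx (hF0 y)
          ((cross y).trans (by rw [hw])) rfl (hy ▸ cross' x : F (G.nbr j y) = F x) hv
        exact this.elim (fun e => Or.inr (Or.inr e)) Or.inl
      · have := P.nbr_mem_of_crossing hwx hyw.symm hxy (hF0 w)
          ((cross w).trans (by rw [hxw])) rfl (hw ▸ cross' y : F (G.nbr j w) = F y) hv
        exact this.elim Or.inl fun e => Or.inr (Or.inl e)
    intro c v hv
    rcases h.eq_or c with rfl | rfl | rfl | rfl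
    · change F (G.nbr 0 v) = _ ∨ F (G.nbr 0 v) = _ ∨ F (G.nbr 0 v) = _
      rw [hF0]; exact hv
    · change F (G.nbr _ v) = _ ∨ F (G.nbr _ v) = _ ∨ F (G.nbr _ v) = _
      rw [← hFij]; exact hj v hv
    · exact hj v hv
    · change F (G.nbr _ v) = _ ∨ F (G.nbr _ v) = _ ∨ F (G.nbr _ v) = _
      rw [hFk]; exact hv
  have hsub : (Set.univ : Set (G.Face k)) ⊆ {F x, F y, F w} := by
    intro f _
    induction f using SimpleGraph.ConnectedComponent.ind with
    | h v => exact closed v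
  rw [← Set.ncard_univ]
  refine (Set.ncard_le_ncard hsub).trans ((Set.ncard_insert_le _ _).trans ?_)
  exact Nat.succ_le_succ (ncard_pair_le _ _)

theorem card_bubble_le_six_of_triangle [Finite V] (P : PlanarCase G i j k) {f : G.Face i}
    (hf : ¬ 4 ≤ G.faceLength f) : Nat.card G.Bubble ≤ 6 := by
  induction f using SimpleGraph.ConnectedComponent.ind with
  | h x =>
    have h3 := P.three_le_faceLength P.triple.1 ((G.keep {0, i}).connectedComponentMk x)
    rw [G.faceLength_mk] at h3 hf
    have h3' : Function.minimalPeriod (G.turn i) x = 3 := by omega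
    have := P.card_face_le_three (x := x)
      (h3' ▸ Function.iterate_minimalPeriod (f := G.turn i) (x := x))
    have := P.loops
    omega

/-- Without a triangle of color `i` or `j` there would be at most `n` faces of these colors, not `n
+ 2`. -/
theorem card_bubble_eq_six [Finite V] (P : PlanarCase G i j k) : Nat.card G.Bubble = 6 := by
  refine le_antisymm ?_ P.six_le_card_bubble
  by_cases hi : ∀ f : G.Face i, 4 ≤ G.faceLength f
  · by_cases hj : ∀ f : G.Face j, 4 ≤ G.faceLength f
    · have h1 := G.mul_card_face_le hi
      have h2 := G.mul_card_face_le hj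
      have := P.planar
      omega
    · push Not at hj
      obtain ⟨f, hf⟩ := hj
      exact P.swap.card_bubble_le_six_of_triangle (not_le.2 hf)
  · push Not at hi
    obtain ⟨f, hf⟩ := hi
    exact P.card_bubble_le_six_of_triangle (not_le.2 hf)

/-- All faces of color `i` are triangles. -/
theorem iterate_turn_three [Finite V] (P : PlanarCase G i j k) (x : V) :
    G.nbr i (G.nbr 0 (G.nbr i (G.nbr 0 (G.nbr i (G.nbr 0 x))))) = x := by
  have h1 := G.mul_card_face_le (P.three_le_faceLength P.triple.1)
  have h2 := G.mul_card_face_le (P.three_le_faceLength P.triple.2.1)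
  have h3 := P.planar
  have h6 := P.card_bubble_eq_six
  -- For `n = 6` there are eight faces of colors `i` and `j`, and at most four of each.
  have h := G.faceLength_eq_of_mul_card_face (P.three_le_faceLength P.triple.1) (by omega)
    ((G.keep {0, i}).connectedComponentMk x)
  rw [G.faceLength_mk] at h
  have h' := Function.iterate_minimalPeriod (f := G.turn i) (x := x)
  rw [h] at h'
  exact h'

end PlanarCase

/-! ### The Coxeter group of type `A₃` -/

/-- Three involutions that satisfy the relations of the simple reflections in the symmetric group
on four letters. -/
structure CoxeterRel (p q r : V → V) : Prop where
  pp : ∀ x, p (p x) = x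
  qq : ∀ x, q (q x) = x
  rr : ∀ x, r (r x) = x
  rp : ∀ x, r (p x) = p (r x)
  qpq : ∀ x, q (p (q x)) = p (q (p x))
  rqr : ∀ x, r (q (r x)) = q (r (q x))

/-- The images of `x` under the reduced words that represent the elements of the group. -/
def coxeterWord (p q r : V → V) (x : V) : Fin 24 → V :=
  ![x, r x, r (q x), r (q (p x)), q x, q (r x), q (r (q x)), q (r (q (p x))), q (p x),
    q (p (r x)), q (p (r (q x))), q (p (r (q (p x)))), p x, p (r x), p (r (q x)),
    p (r (q (p x))), p (q x), p (q (r x)), p (q (r (q x))), p (q (r (q (p x)))), p (q (p x)),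
    p (q (p (r x))), p (q (p (r (q x)))), p (q (p (r (q (p x)))))]

/-- Left multiplication by the first reflection on the list of reduced words. -/
def coxeterMulP : Fin 24 → Fin 24 :=
  ![12, 13, 14, 15, 16, 17, 18, 19, 20, 21, 22, 23, 0, 1, 2, 3, 4, 5, 6, 7, 8, 9, 10, 11]

/-- Left multiplication by the second reflection on the list of reduced words. -/
def coxeterMulQ : Fin 24 → Fin 24 :=
  ![4, 5, 6, 7, 0, 1, 2, 3, 12, 13, 14, 15, 8, 9, 10, 11, 20, 21, 22, 23, 16, 17, 18, 19]

/-- Left multiplication by the third reflection on the list of reduced words. -/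
def coxeterMulR : Fin 24 → Fin 24 :=
  ![1, 0, 4, 8, 2, 6, 5, 9, 3, 7, 11, 10, 13, 12, 16, 20, 14, 18, 17, 21, 15, 19, 23, 22]

namespace CoxeterRel

variable {p q r : V → V}

/-- Since `rp` moves `p` to the left of `r`, the word `r q r p` becomes `r q p r`, to which `rqr` no
longer applies; this rule resolves the overlap. -/
theorem rqpr (h : CoxeterRel p q r) (x : V) : r (q (p (r x))) = q (r (q (p x))) := by
  rw [← h.rp, h.rqr]

/-- The list consists of the six words in `p`, `q` for the parabolic subgroup, each followed by one
of the coset representatives `1`, `r`, `rq`, `rqp`. The tables do not depend on the action, so they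
can be compared between two graphs. -/
theorem word_mulP (h : CoxeterRel p q r) (x : V) (t : Fin 24) :
    coxeterWord p q r x (coxeterMulP t) = p (coxeterWord p q r x t) := by
  fin_cases t <;> simp [coxeterWord, coxeterMulP, h.pp]

theorem word_mulQ (h : CoxeterRel p q r) (x : V) (t : Fin 24) :
    coxeterWord p q r x (coxeterMulQ t) = q (coxeterWord p q r x t) := by
  fin_cases t <;> simp [coxeterWord, coxeterMulQ, h.pp, h.qq, h.qpq]

theorem word_mulR (h : CoxeterRel p q r) (x : V) (t : Fin 24) :
    coxeterWord p q r x (coxeterMulR t) = r (coxeterWord p q r x t) := by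
  fin_cases t <;> simp [coxeterWord, coxeterMulR, h.pp, h.qq, h.rr, h.rp, h.qpq, h.rqr, h.rqpr]

end CoxeterRel

/-- Triangles of colors `i` and `j` are the two braid relations with `nbr 0`; `nbr i` and `nbr j`
commute inside a bubble. -/
theorem coxeterRel_of_triangles (G : TetraGraph V) {i j k : Fin 4} (h : IsTriple i j k)
    (hi : ∀ x, G.nbr i (G.nbr 0 (G.nbr i (G.nbr 0 (G.nbr i (G.nbr 0 x))))) = x)
    (hj : ∀ x, G.nbr j (G.nbr 0 (G.nbr j (G.nbr 0 (G.nbr j (G.nbr 0 x))))) = x) :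
    CoxeterRel (G.nbr i) (G.nbr 0) (G.nbr j) where
  pp := G.nbr_nbr i
  qq := G.nbr_nbr 0
  rr := G.nbr_nbr j
  rp x := by rw [G.nbr_mul h, G.nbr_mul h.swap]
  qpq x := by
    have := hi x
    rwa [G.nbr_eq_iff, G.nbr_eq_iff, G.nbr_eq_iff] at this
  rqr x := by
    have := hj (G.nbr j x)
    rwa [G.nbr_eq_iff, G.nbr_eq_iff, G.nbr_eq_iff, G.nbr_nbr, G.nbr_eq_iff] at this

/-! ### The octahedral graph -/

theorem octahedralGraph_turn_one (x : OctHalfEdge) : (octahedralGraph.turn 1)^[3] x = x := by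
  revert x; decide +kernel

theorem octahedralGraph_turn_two (x : OctHalfEdge) : (octahedralGraph.turn 2)^[3] x = x := by
  revert x; decide +kernel

theorem octahedralGraph_turn_three (x : OctHalfEdge) : (octahedralGraph.turn 3)^[4] x = x := by
  revert x; decide +kernel

theorem octahedralGraph_turn_ne (c : Fin 4) (hc : c ≠ 0) (x : OctHalfEdge) :
    octahedralGraph.turn c x ≠ x := by
  revert x c; decide +kernel

theorem octahedralGraph_turn_turn_ne (x : OctHalfEdge) :
    octahedralGraph.turn 3 (octahedralGraph.turn 3 x) ≠ x := by
  revert x; decide +kernel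

theorem octahedralGraph_coxeterRel :
    CoxeterRel (octahedralGraph.nbr 1) (octahedralGraph.nbr 0) (octahedralGraph.nbr 2) :=
  octahedralGraph.coxeterRel_of_triangles isTriple_one_two_three octahedralGraph_turn_one
    octahedralGraph_turn_two

/-- The half-edge from `e₀` to `e₁`. -/
def octBase : OctHalfEdge := ⟨((0, 0), (1, 0)), by decide⟩

theorem octahedralGraph_word_bijective : Function.Bijective
    (coxeterWord (octahedralGraph.nbr 1) (octahedralGraph.nbr 0) (octahedralGraph.nbr 2)
      octBase) := by
  have hcard : Fintype.card (Fin 24) = Fintype.card OctHalfEdge := by decide +kernel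
  rw [Fintype.bijective_iff_injective_and_card]
  refine ⟨?_, hcard⟩
  unfold Function.Injective
  decide +kernel

theorem octahedralGraph_faceLength_one_two {c : Fin 4} (hc : c = 1 ∨ c = 2)
    (f : octahedralGraph.Face c) : octahedralGraph.faceLength f = 3 := by
  induction f using SimpleGraph.ConnectedComponent.ind with
  | h x =>
    have : Fact (Nat.Prime 3) := ⟨Nat.prime_three⟩
    rw [faceLength_mk]
    refine Function.minimalPeriod_eq_prime ?_ ?_
    · rcases hc with rfl | rfl
      exacts [octahedralGraph_turn_one x, octahedralGraph_turn_two x]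
    · exact octahedralGraph_turn_ne c (by rcases hc with rfl | rfl <;> decide) x

theorem octahedralGraph_faceLength_three (f : octahedralGraph.Face 3) :
    octahedralGraph.faceLength f = 4 := by
  induction f using SimpleGraph.ConnectedComponent.ind with
  | h x =>
    have : Fact (Nat.Prime 2) := ⟨Nat.prime_two⟩
    rw [faceLength_mk]
    exact Function.minimalPeriod_eq_prime_pow (p := 2) (k := 1)
      (octahedralGraph_turn_turn_ne x) (octahedralGraph_turn_three x)

theorem octahedralGraph_dipoleFree : octahedralGraph.DipoleFree := by
  rintro c hc ⟨f, hf, -⟩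
  have key : (c = 1 ∨ c = 2) ∨ c = 3 := by clear hf f; revert c; decide
  rcases key with hc | rfl
  · rw [octahedralGraph_faceLength_one_two hc] at hf
    omega
  · rw [octahedralGraph_faceLength_three] at hf
    omega

theorem card_octHalfEdge : Nat.card OctHalfEdge = 24 := by
  rw [Nat.card_eq_fintype_card]
  decide +kernel

theorem mul_card_face_of_faceLength_eq [Finite V] (G : TetraGraph V) {c : Fin 4} {m : ℕ}
    (hm : ∀ f : G.Face c, G.faceLength f = m) :
    m * Nat.card (G.Face c) = 2 * Nat.card G.Bubble := by
  have := Fintype.ofFinite (G.Face c)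
  have h2 := G.sum_faceLength c
  have h3 := G.four_mul_card_bubble
  rw [Finset.sum_congr rfl fun f _ => hm f, Finset.sum_const, Finset.card_univ, smul_eq_mul,
    ← Nat.card_eq_fintype_card, mul_comm (Nat.card (G.Face c))] at h2
  omega

theorem octahedralGraph_degree : octahedralGraph.degree = 1 := by
  have h := octahedralGraph.four_mul_card_bubble
  rw [card_octHalfEdge] at h
  have hb : Nat.card octahedralGraph.Bubble = 6 := by omega
  have h1 := octahedralGraph.mul_card_face_of_faceLength_eq
    (octahedralGraph_faceLength_one_two (Or.inl rfl))
  have h2 := octahedralGraph.mul_card_face_of_faceLength_eq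
    (octahedralGraph_faceLength_one_two (Or.inr rfl))
  have h3 := octahedralGraph.mul_card_face_of_faceLength_eq octahedralGraph_faceLength_three
  have e1 : Nat.card (octahedralGraph.Face 1) = 4 := by omega
  have e2 : Nat.card (octahedralGraph.Face 2) = 4 := by omega
  have e3 : Nat.card (octahedralGraph.Face 3) = 3 := by omega
  rw [degree_eq, hb, e1, e2, e3]
  norm_num

theorem connected_of_reachable_nbr {H : SimpleGraph OctHalfEdge}
    (hH : ∀ c x, H.Reachable x (octahedralGraph.nbr c x)) : H.Connected := by
  have hw : ∀ t, H.Reachable octBase (coxeterWord (octahedralGraph.nbr 1) (octahedralGraph.nbr 0)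
      (octahedralGraph.nbr 2) octBase t) := by
    have h := fun c x (hx : H.Reachable octBase x) => hx.trans (hH c x)
    intro t
    fin_cases t <;> dsimp [coxeterWord] <;> repeat (first | rfl | apply h)
  have hall : ∀ x, H.Reachable octBase x := fun x => by
    obtain ⟨t, rfl⟩ := octahedralGraph_word_bijective.2 x
    exact hw t
  exact { preconnected := fun x y => (hall x).symm.trans (hall y), nonempty := ⟨octBase⟩ }

theorem octahedralGraph_isConnected : octahedralGraph.IsConnected :=
  connected_of_reachable_nbr fun c _ => SimpleGraph.Adj.reachable ⟨c, Finset.mem_univ c, rfl⟩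

/-- The ends of an edge of color `0` in a triangle of color `c` remain connected when that edge is
removed. -/
theorem reachable_of_triangle (G : TetraGraph V) {T : Set (Sym2 V)} {c : Fin 4} (hc : c ≠ 0)
    {x : V} (hx : (G.turn c)^[3] x = x)
    (h1 : s(G.turn c x, G.nbr 0 (G.turn c x)) ∉ T)
    (h2 : s(G.nbr c x, G.nbr 0 (G.nbr c x)) ∉ T) : (G.cut T).Reachable x (G.nbr 0 x) := by
  have hstep : ∀ y, (G.cut T).Reachable y (G.nbr c y) := fun y =>
    SimpleGraph.Adj.reachable ⟨c, rfl, fun h => hc h.1⟩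
  have hy : G.turn c (G.turn c x) = G.nbr 0 (G.nbr c x) := by
    rw [← G.nbr_eq_iff, ← G.nbr_eq_iff]
    exact hx
  have a1 : (G.cut T).Reachable (G.turn c x) (G.nbr 0 (G.turn c x)) :=
    SimpleGraph.Adj.reachable ⟨0, rfl, fun h => h1 h.2⟩
  have a2 : (G.cut T).Reachable (G.nbr c x) (G.nbr 0 (G.nbr c x)) :=
    SimpleGraph.Adj.reachable ⟨0, rfl, fun h => h2 h.2⟩
  have a3 := hstep (G.nbr 0 (G.turn c x))
  rw [show G.nbr c (G.nbr 0 (G.turn c x)) = G.nbr 0 (G.nbr c x) from hy] at a3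
  exact (hstep x).trans (a2.trans (a3.symm.trans (a1.symm.trans (hstep (G.nbr 0 x)).symm)))

/-- The edge of color `0` at a vertex of the octahedral graph. -/
abbrev octEdge (x : OctHalfEdge) : Sym2 OctHalfEdge := s(x, octahedralGraph.nbr 0 x)

set_option synthInstance.maxSize 1024 in
/-- The two triangles at an edge of color `0` consist of five different edges of color `0`. -/
theorem octahedralGraph_nodup_triangles (x : OctHalfEdge) :
    (List.map octEdge [x, octahedralGraph.turn 1 x, octahedralGraph.nbr 1 x,
      octahedralGraph.turn 2 x, octahedralGraph.nbr 2 x]).Nodup := by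
  revert x; decide +kernel

theorem octahedralGraph_is2PI : octahedralGraph.Is2PI := by
  have hpair : ∀ x y : OctHalfEdge,
      (octahedralGraph.cut {s(x, octahedralGraph.nbr 0 x), s(y, octahedralGraph.nbr 0 y)}).Reachable
        x (octahedralGraph.nbr 0 x) := by
    intro x y
    have hx := octahedralGraph_nodup_triangles x
    simp only [List.map_cons, List.map_nil, List.nodup_cons, List.mem_cons, List.not_mem_nil,
      or_false, not_or, List.nodup_nil, and_true, not_false_iff] at hx
    obtain ⟨⟨h1, h2, h3, h4⟩, ⟨-, h5, h6⟩, ⟨h7, h8⟩, -⟩ := hx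
    -- The two triangles at `x` share only the edge at `x`, so the other removed edge spares one of
    -- them, which serves as a detour.
    by_cases hy : octEdge (octahedralGraph.turn 1 x) = octEdge y ∨
      octEdge (octahedralGraph.nbr 1 x) = octEdge y
    · refine octahedralGraph.reachable_of_triangle (by decide) (octahedralGraph_turn_two x) ?_ ?_
      · rintro (h | h)
        · exact h3 h.symm
        · exact hy.elim (fun e => h5 (e.trans h.symm)) fun e => h7 (e.trans h.symm)
      · rintro (h | h)
        · exact h4 h.symm
        · exact hy.elim (fun e => h6 (e.trans h.symm)) fun e => h8 (e.trans h.symm)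
    · refine octahedralGraph.reachable_of_triangle (by decide) (octahedralGraph_turn_one x) ?_ ?_
      · rintro (h | h)
        exacts [h1 h.symm, hy (Or.inl h)]
      · rintro (h | h)
        exacts [h2 h.symm, hy (Or.inr h)]
  rintro _ ⟨x, rfl⟩ _ ⟨y, rfl⟩ -
  refine connected_of_reachable_nbr fun c w => ?_
  by_cases hw : c = 0 ∧ s(w, octahedralGraph.nbr 0 w) ∈
      ({s(x, octahedralGraph.nbr 0 x), s(y, octahedralGraph.nbr 0 y)} : Set (Sym2 OctHalfEdge))
  · obtain ⟨rfl, h | h⟩ := hw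
    · have := hpair w y
      rwa [h] at this
    · have := hpair w x
      rwa [Set.pair_comm, Set.mem_singleton_iff.1 h] at this
  · refine SimpleGraph.Adj.reachable ⟨c, rfl, ?_⟩
    rintro ⟨rfl, h⟩
    exact hw ⟨rfl, h⟩

/-! ### The classification -/

theorem IsTriple.exists_perm {i j k : Fin 4} (h : IsTriple i j k) :
    ∃ π : Equiv.Perm (Fin 4), π 0 = 0 ∧ π i = 1 ∧ π j = 2 ∧ π k = 3 := by
  rcases h.cases with ⟨rfl, rfl, rfl⟩ | ⟨rfl, rfl, rfl⟩ | ⟨rfl, rfl, rfl⟩ |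
    ⟨rfl, rfl, rfl⟩ | ⟨rfl, rfl, rfl⟩ | ⟨rfl, rfl, rfl⟩
  · exact ⟨1, by decide⟩
  · exact ⟨Equiv.swap 1 2, by decide⟩
  · exact ⟨Equiv.swap 2 3, by decide⟩
  · exact ⟨Equiv.swap 1 2 * Equiv.swap 1 3, by decide⟩
  · exact ⟨Equiv.swap 2 3 * Equiv.swap 1 3, by decide⟩
  · exact ⟨Equiv.swap 1 3, by decide⟩

theorem PlanarCase.sameUpToColors [Finite V] {G : TetraGraph V} {i j k : Fin 4}
    (P : PlanarCase G i j k) : G.SameUpToColors octahedralGraph := by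
  have h := P.triple
  have hrel := G.coxeterRel_of_triangles h P.iterate_turn_three P.swap.iterate_turn_three
  obtain ⟨x⟩ := P.connected.nonempty
  set θ := coxeterWord (G.nbr i) (G.nbr 0) (G.nbr j) x
  have hP : ∀ t, G.nbr i (θ t) = θ (coxeterMulP t) := fun t => (hrel.word_mulP x t).symm
  have hQ : ∀ t, G.nbr 0 (θ t) = θ (coxeterMulQ t) := fun t => (hrel.word_mulQ x t).symm
  have hR : ∀ t, G.nbr j (θ t) = θ (coxeterMulR t) := fun t => (hrel.word_mulR x t).symm
  have hsurj : Function.Surjective θ := by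
    refine G.eq_univ_of_closed P.connected (T := Set.range θ) ⟨0, rfl⟩ ?_
    rintro c _ ⟨t, rfl⟩
    rcases h.eq_or c with rfl | rfl | rfl | rfl
    · exact ⟨_, (hQ t).symm⟩
    · exact ⟨_, (hP t).symm⟩
    · exact ⟨_, (hR t).symm⟩
    · exact ⟨coxeterMulP (coxeterMulR t), by rw [← hP, ← hR, G.nbr_mul h]⟩
  have hcard : Nat.card V = 24 := by rw [G.four_mul_card_bubble, P.card_bubble_eq_six]
  -- The surjection from 24 words onto 24 vertices is bijective, so the action is regular.
  have hbij : Function.Bijective θ := hsurj.bijective_of_nat_card_le (by simp [hcard])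
  have hrel' := octahedralGraph_coxeterRel
  obtain ⟨π, h0, hi, hj, hk⟩ := h.exists_perm
  refine ⟨(Equiv.ofBijective θ hbij).symm.trans
    (Equiv.ofBijective _ octahedralGraph_word_bijective), π, h0, fun c v => ?_⟩
  obtain ⟨t, rfl⟩ := hsurj v
  have key : ∀ t, (Equiv.ofBijective θ hbij).symm (θ t) = t :=
    fun t => Equiv.ofBijective_symm_apply_apply θ hbij t
  rcases h.eq_or c with rfl | rfl | rfl | rfl
  · simp only [hQ, h0, Equiv.trans_apply, key, Equiv.ofBijective_apply, hrel'.word_mulQ]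
  · simp only [hP, hi, Equiv.trans_apply, key, Equiv.ofBijective_apply, hrel'.word_mulP]
  · simp only [hR, hj, Equiv.trans_apply, key, Equiv.ofBijective_apply, hrel'.word_mulR]
  · simp only [← G.nbr_mul h, hP, hR, hk, Equiv.trans_apply, key, Equiv.ofBijective_apply,
      hrel'.word_mulP, hrel'.word_mulR, octahedralGraph.tetra]

theorem sameUpToColors_octahedralGraph [Finite V] (G : TetraGraph V) (hG : G.IsConnected)
    (h2 : G.Is2PI) (hd : G.DipoleFree) (hdeg : G.degree = 1) :
    G.SameUpToColors octahedralGraph := by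
  have h := isTriple_one_two_three
  have hF : 2 * (Nat.card (G.Face 1) + Nat.card (G.Face 2) + Nat.card (G.Face 3)) =
      3 * Nat.card G.Bubble + 4 := by
    rw [G.degree_eq] at hdeg
    have : (2 * (Nat.card (G.Face 1) + Nat.card (G.Face 2) + Nat.card (G.Face 3)) : ℚ) =
        3 * Nat.card G.Bubble + 4 := by linarith
    exact_mod_cast this
  have h12 := (G.card_face_add_card_face_le hG h).1
  have h23 := (G.card_face_add_card_face_le hG h.rotate).1
  have h31 := (G.card_face_add_card_face_le hG h.rotate.rotate).1
  -- The three defects in `h12`, `h23`, `h31` are nonnegative integers with sum two, so one of them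
  -- vanishes.
  by_cases e12 : Nat.card (G.Face 1) + Nat.card (G.Face 2) = Nat.card G.Bubble + 2
  · exact PlanarCase.sameUpToColors ⟨h, hG, h2, hd, e12, by omega⟩
  by_cases e23 : Nat.card (G.Face 2) + Nat.card (G.Face 3) = Nat.card G.Bubble + 2
  · exact PlanarCase.sameUpToColors ⟨h.rotate, hG, h2, hd, e23, by omega⟩
  exact PlanarCase.sameUpToColors ⟨h.rotate.rotate, hG, h2, hd, by omega, by omega⟩

end TetraGraph

theorem theorem6p1 :
    (octahedralGraph.IsConnected ∧ octahedralGraph.Is2PI ∧ octahedralGraph.DipoleFree ∧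
      octahedralGraph.degree = 1) ∧
    ∀ (V : Type u) [Finite V] (G : TetraGraph V),
      G.IsConnected → G.Is2PI → G.DipoleFree → G.degree = 1 →
        G.SameUpToColors octahedralGraph :=
  ⟨⟨TetraGraph.octahedralGraph_isConnected, TetraGraph.octahedralGraph_is2PI,
    TetraGraph.octahedralGraph_dipoleFree, TetraGraph.octahedralGraph_degree⟩,
    fun _ _ G hG h2 hd hdeg => G.sameUpToColors_octahedralGraph hG h2 hd hdeg⟩
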